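/- Let $k$ be a field of characteristic $p>0$, let $\ell\neq p$ be a prime, let $n\ge 1$, and put $\Lambda_n=\mathbb Z/\ell^n\mathbb Z$. Let $U$ be a smooth curve over $k$ (that is, a separated scheme, smooth of relative dimension $1$ and of finite type over $k$; it need not be connected). Let $\mathcal V_n$ be a locally constant sheaf of free $\Lambda_n$-modules of finite rank on the small étale site of $U$, that is, a sheaf of $\Lambda_n$-modules such that there is an étale covering $\{U_i\to U\}$ for which each restriction $\mathcal V_n|_{U_i}$ is isomorphic to a constant sheaf whose value is a free $\Lambda_n$-module of finite rank. For a $\Lambda_n$-module $M$ put $M^*=\{v\in M:\ \ell^{\,n-1}v\neq 0\}$. Let $\mathcal V_n^*\subset\mathcal V_n$ be the subsheaf of sets whose sections over an étale $U$-scheme $T$ are the $v\in\mathcal V_n(T)$ such that $v|_{T'}\in\mathcal V_n(T')^*$ for every nonempty étale $T$-scheme $T'$. The group $\Lambda_n^*$ of invertible elements of $\Lambda_n$ acts on $\mathcal V_n^*$ by multiplication. Let $P_n(\mathcal V_n)=\mathcal V_n^*/\Lambda_n^*$ be the quotient sheaf, i.e. the sheaf associated with the presheaf $T\mapsto\mathcal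 V_n^*(T)/\Lambda_n^*$ on the small étale site of $U$. Then there is a finite étale $U$-scheme $U_n$ which represents the sheaf $P_n(\mathcal V_n)$: there is an isomorphism $P_n(\mathcal V_n)(T)\cong\mathrm{Hom}_U(T,U_n)$, functorial in the étale $U$-scheme $T$. -/

import Mathlib

open CategoryTheory AlgebraicGeometry Opposite

universe u

noncomputable section

namespace EtaleProj

/-- The forgetful functor from `R`-modules to sets preserves filtered colimits (needed in order to
sheafify presheaves of `R`-modules on a small étale site, where `R` lives in the lowest universe). -/
instance forget_preservesFilteredColimitsOfSize (R : Type) [Ring R] :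
    Limits.PreservesFilteredColimitsOfSize.{u, u} (forget (ModuleCat.{u} R)) :=
  have : Limits.PreservesColimitsOfSize.{u, u}
      (forget₂ (ModuleCat.{u} R) AddCommGrpCat.{u}) := inferInstance
  Limits.comp_preservesFilteredColimits (forget₂ (ModuleCat.{u} R) AddCommGrpCat.{u})
    (forget AddCommGrpCat)

/-- The ring `Λₙ = ℤ/ℓⁿℤ`. -/
abbrev Lam (ℓ n : ℕ) : Type := ZMod (ℓ ^ n)

/-- Sheaves of `R`-modules on the small étale site of `U`. -/
abbrev ModSheaf (U : Scheme.{u}) (R : Type) [Ring R] :=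
  Sheaf U.smallEtaleTopology (ModuleCat.{u} R)

/-- For `X` étale over `U`, an étale `X`-scheme is an étale `U`-scheme by composition with
`X ⟶ U`. -/
def postcomp {U : Scheme.{u}} (X : U.Etale) : X.left.Etale ⥤ U.Etale where
  obj Y := Scheme.Etale.mk (Y.hom ≫ X.hom)
  map g := MorphismProperty.Over.homMk g.left
    ((Category.assoc _ _ _).symm.trans
      (congrArg (· ≫ X.hom) (CategoryTheory.Over.w ((Scheme.Etale.forget _).map g))))

/-- The restriction of `V` to the small étale site of the étale `U`-scheme `X` is isomorphic to the
constant sheaf with value `M`. -/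
def IsConstantOn {U : Scheme.{u}} {R : Type} [Ring R] (V : ModSheaf U R) (X : U.Etale)
    (M : ModuleCat.{u} R) : Prop :=
  Nonempty ((postcomp X).op ⋙ V.obj ≅
    ((constantSheaf X.left.smallEtaleTopology (ModuleCat.{u} R)).obj M).obj)

/-- `V` is a locally constant sheaf of free `R`-modules of finite rank: there is a covering of the
final object of the small étale site of `U` such that, on each of its members, `V` is isomorphic to
a constant sheaf whose value is a free module of finite rank. -/
def IsLocallyConstantFree {U : Scheme.{u}} {R : Type} [Ring R] (V : ModSheaf U R) : Prop :=
  ∃ (I : Type u) (X : I → U.Etale), U.smallEtaleTopology.CoversTop X ∧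
    ∀ i, ∃ M : ModuleCat.{u} R, Module.Free R M ∧ Module.Finite R M ∧ IsConstantOn V (X i) M

/-- For a `Λₙ`-module `M`, the set `M^* = {v ∈ M | ℓ^(n-1) v ≠ 0}` (where `1 ≤ n`). -/
def starSet (ℓ n : ℕ) (M : Type*) [AddCommGroup M] : Set M :=
  {v | ℓ ^ (n - 1) • v ≠ 0}

/-- The subsheaf `V^*` of the sheaf `V` of `Λₙ`-modules: its sections over `T` are the `v ∈ V(T)`
which lie in `V(T')^*` after restriction to any nonempty étale `T'` over `T`. The restrictions are
necessary: for disconnected or empty `T`, a section in `V(T)^*` may restrict to zero somewhere, so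
that `T ↦ V(T)^*` is not functorial. -/
def starSubfunctor {U : Scheme.{u}} {ℓ n : ℕ} (V : ModSheaf U (Lam ℓ n)) :
    Subfunctor (V.obj ⋙ forget (ModuleCat.{u} (Lam ℓ n))) where
  obj T := {v : V.obj.obj T | ∀ (T' : U.Etale) (f : T' ⟶ T.unop), Nonempty T'.left →
    (V.obj.map f.op).hom v ∈ starSet ℓ n (V.obj.obj (op T'))}
  map {T S} i v hv T' f hT' := by
    have h := hv T' (f ≫ i.unop) hT'
    rw [op_comp, Functor.map_comp] at h
    exact h

/-- Two sections of `V^*` over `T` are equivalent if they are in the same orbit of `Λₙˣ`. -/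
def orbitSetoid {U : Scheme.{u}} {ℓ n : ℕ} (V : ModSheaf U (Lam ℓ n)) (T : U.Etaleᵒᵖ) :
    Setoid ((starSubfunctor V).obj T) where
  r v w := ∃ c : (Lam ℓ n)ˣ, (c : Lam ℓ n) • (v.1 : V.obj.obj T) = (w.1 : V.obj.obj T)
  iseqv :=
    { refl := fun v => ⟨1, by simp⟩
      symm := fun {v w} ⟨c, hc⟩ => ⟨c⁻¹, by rw [← hc, smul_smul]; simp⟩
      trans := fun {v w x} ⟨c, hc⟩ ⟨d, hd⟩ =>
        ⟨d * c, by rw [← hd, ← hc, smul_smul, Units.val_mul]⟩ }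

/-- The presheaf `T ↦ V^*(T) / Λₙˣ` on the small étale site of `U`. -/
def projPresheaf {U : Scheme.{u}} {ℓ n : ℕ} (V : ModSheaf U (Lam ℓ n)) : U.Etaleᵒᵖ ⥤ Type u where
  obj T := Quotient (orbitSetoid V T)
  map {T S} i := TypeCat.ofHom (Quotient.map' ((starSubfunctor V).toFunctor.map i) (by
    rintro v w ⟨c, hc⟩
    refine ⟨c, ?_⟩
    have := congrArg (V.obj.map i).hom hc
    rw [map_smul] at this
    exact this))
  map_id T := by
    ext x
    induction x using Quotient.inductionOn
    simp
    rfl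
  map_comp f g := by
    ext x
    induction x using Quotient.inductionOn
    simp
    rfl

/-- The projectivisation `Pₙ(V)`: the quotient sheaf of `V^*` by `Λₙˣ`, that is, the sheaf
associated with the presheaf `T ↦ V^*(T) / Λₙˣ`. -/
def proj {U : Scheme.{u}} {ℓ n : ℕ} (V : ModSheaf U (Lam ℓ n)) :
    Sheaf U.smallEtaleTopology (Type u) :=
  (presheafToSheaf U.smallEtaleTopology (Type u)).obj (projPresheaf V)

end EtaleProj

end

/-! Where `V` is constant with value `M`, the sheaf `Pₙ(V)` is constant with value `M^*` modulo
units, a finite set because `Λₙ` is finite and `M` is finitely generated. So `Pₙ(V)` is a locally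
constant sheaf of finite sets on a noetherian scheme, and the task is to descend the finite étale
schemes that represent it locally.

Choose finitely many affine étale `X i` covering `U` on which a sheaf `G` of this kind is constant
with value `S i`. Over `X i` it is represented by `N i`, a disjoint union of copies of `X i` indexed
by `S i` (`IsConstData.exists_isRelRep`). On `Y = ∐ N i` there is a tautological section `y`, and
the two pullbacks of `y` to `Y ×_U Y` agree exactly over an open `R` (`exists_eqRel`). The
representing scheme must be the quotient of `Y` by `R`.

The quotient is built directly: `Q` is the relative spectrum over `U` of the functions on `Y` whose
two pullbacks to `R` agree. An equalizer of rings commutes with flat base change, so over `X i` the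
scheme `Q` is a coequalizer among affine schemes (`ParallelOver.existsUnique_comp_eq`). The morphism
from `Y` over `X i` to `N i` that classifies `y` is invariant, and comparing it with the inclusion
of `N i` in `Y` identifies the pullback of `Q` with `N i` (`EqRel.exists_iso_pullback`). Finiteness
and étaleness then descend to `Q`, and `y` descends along `Y ⟶ Q` to a universal section
(`nonempty_representableBy`). -/

noncomputable section

/-! ### Rings of invariant functions and their localizations -/

namespace EtaleProj
open Limits Scheme AffineZariskiSite

/-- A pair of parallel morphisms `p, q : R ⟶ Y` of schemes over `S`. -/
structure ParallelOver (S : Scheme.{u}) where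
  /-- the target -/
  Y : Scheme.{u}
  /-- the source -/
  R : Scheme.{u}
  /-- the structure morphism of the target -/
  π : Y ⟶ S
  /-- the structure morphism of the source -/
  ρ : R ⟶ S
  /-- the first morphism -/
  p : R ⟶ Y
  /-- the second morphism -/
  q : R ⟶ Y
  hp : p ≫ π = ρ
  hq : q ≫ π = ρ

namespace ParallelOver

variable {S : Scheme.{u}} (D : ParallelOver S)

lemma le_p (W : S.Opens) : D.ρ ⁻¹ᵁ W ≤ D.p ⁻¹ᵁ D.π ⁻¹ᵁ W := by
  rw [← Scheme.Hom.comp_preimage, D.hp]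

lemma le_q (W : S.Opens) : D.ρ ⁻¹ᵁ W ≤ D.q ⁻¹ᵁ D.π ⁻¹ᵁ W := by
  rw [← Scheme.Hom.comp_preimage, D.hq]

/-- The functions on the preimage of `W` in `Y` whose pullbacks to `R` along `p` and `q` agree. -/
def eqSub (W : S.Opens) : Subring Γ(D.Y, D.π ⁻¹ᵁ W) :=
  RingHom.eqLocus (D.p.appLE _ _ (D.le_p W)).hom (D.q.appLE _ _ (D.le_q W)).hom

lemma mem_eqSub {W : S.Opens} {x : Γ(D.Y, D.π ⁻¹ᵁ W)} : x ∈ D.eqSub W ↔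
    D.p.appLE _ _ (D.le_p W) x = D.q.appLE _ _ (D.le_q W) x := Iff.rfl

lemma map_mem_eqSub {W W' : S.Opens} (h : W' ≤ W) {x : Γ(D.Y, D.π ⁻¹ᵁ W)} (hx : x ∈ D.eqSub W) :
    D.Y.presheaf.map (homOfLE (D.π.preimage_mono h)).op x ∈ D.eqSub W' := by
  rw [mem_eqSub] at hx ⊢
  have := congr(D.R.presheaf.map (homOfLE (D.ρ.preimage_mono h)).op $hx)
  simpa only [← CommRingCat.comp_apply, Scheme.Hom.map_appLE, Scheme.Hom.appLE_map] using this

lemma app_mem_eqSub (W : S.Opens) (x : Γ(S, W)) : D.π.app W x ∈ D.eqSub W := by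
  rw [mem_eqSub]
  simp only [← CommRingCat.comp_apply, Scheme.Hom.app_eq_appLE, Scheme.Hom.appLE_comp_appLE, D.hp,
    D.hq]

/-- The presheaf of rings `W ↦ eqSub W`. -/
def diagram : S.Opensᵒᵖ ⥤ CommRingCat.{u} where
  obj W := .of (D.eqSub W.unop)
  map {V W} i :=
    CommRingCat.ofHom ((D.Y.presheaf.map (homOfLE (D.π.preimage_mono i.unop.le)).op).hom.restrict
      _ _ fun _ hx ↦ D.map_mem_eqSub i.unop.le hx)
  map_id W := by simp; rfl
  map_comp i j := by
    simp only [← CommRingCat.ofHom_comp]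
    rw [← homOfLE_comp (D.π.preimage_mono j.unop.le) (D.π.preimage_mono i.unop.le), op_comp]
    simp_rw [D.Y.presheaf.map_comp]
    rfl

/-- The structure morphism of the presheaf of algebras `D.diagram`. -/
def diagramMap : S.presheaf ⟶ D.diagram where
  app W := CommRingCat.ofHom ((D.π.app W.unop).hom.codRestrict (D.eqSub W.unop)
    (D.app_mem_eqSub W.unop))
  naturality {U V} i := by ext x; exact Subtype.ext congr($(D.π.naturality i) x)

section

variable [QuasiCompact D.π] [QuasiSeparated D.π] [QuasiCompact D.ρ]

/-- For `f` quasi-compact and quasi-separated, sections over the preimage of a basic open are the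
localization at the pullback of `r`, so denominators can be cleared. -/
lemma _root_.AlgebraicGeometry.Scheme.Hom.exists_pow_mul_eq_map {X Y : Scheme.{u}} (f : X ⟶ Y)
    [QuasiCompact f] [QuasiSeparated f] {U : Y.Opens} (hU : IsAffineOpen U) (r : Γ(Y, U))
    (x : Γ(X, f ⁻¹ᵁ Y.basicOpen r)) :
    ∃ (n : ℕ) (y : Γ(X, f ⁻¹ᵁ U)), X.presheaf.map (homOfLE (f.preimage_mono
      (Y.basicOpen_le r))).op y = X.presheaf.map (homOfLE (f.preimage_mono
      (Y.basicOpen_le r))).op (f.app U r) ^ n * x := by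
  let inst : Algebra Γ(X, f ⁻¹ᵁ U) Γ(X, f ⁻¹ᵁ Y.basicOpen r) :=
    (X.presheaf.map (homOfLE (f.preimage_mono (Y.basicOpen_le r))).op).hom.toAlgebra
  have : IsLocalization.Away (f.app U r) Γ(X, f ⁻¹ᵁ Y.basicOpen r) := by
    let : Algebra Γ(X, f ⁻¹ᵁ U) Γ(X, X.basicOpen (f.app _ r)) :=
      (X.presheaf.map (homOfLE (X.basicOpen_le _)).op).hom.toAlgebra
    dsimp +instances [inst]
    rw! (castMode := .all) [f.preimage_basicOpen r]
    exact isLocalization_basicOpen_of_qcqs (f.isCompact_preimage hU.isCompact)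
        (f.isQuasiSeparated_preimage hU.isQuasiSeparated) (f.app _ r)
  obtain ⟨n, y, hy⟩ := IsLocalization.Away.surj (f.app U r) x
  exact ⟨n, y, by rw [mul_comm]; exact hy.symm⟩

lemma _root_.AlgebraicGeometry.Scheme.Hom.exists_pow_mul_eq_zero {X Y : Scheme.{u}} (f : X ⟶ Y)
    [QuasiCompact f] {U : Y.Opens} (hU : IsAffineOpen U) (r : Γ(Y, U))
    (x : Γ(X, f ⁻¹ᵁ U)) (hx : X.presheaf.map (homOfLE (f.preimage_mono
      (Y.basicOpen_le r))).op x = 0) : ∃ n : ℕ, f.app U r ^ n * x = 0 := by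
  refine exists_pow_mul_eq_zero_of_res_basicOpen_eq_zero_of_isCompact X
    (f.isCompact_preimage hU.isCompact) x (f.app U r) ?_
  have := congr(X.presheaf.map (homOfLE (f.preimage_basicOpen r).ge).op $hx)
  rw [map_zero, ← CommRingCat.comp_apply, ← X.presheaf.map_comp] at this
  exact this

/-- This is the condition for the spectra of the rings `eqSub W` to glue along basic opens. It holds
because an equalizer of two ring maps commutes with localization: denominators are cleared on `Y`,
and the remaining failure of invariance is killed on `R`. -/
lemma coequifibered_diagramMap :
    ((toOpensFunctor S).op.whiskerLeft D.diagramMap).Coequifibered := by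
  refine coequifibered_iff_forall_isLocalizationAway.mpr fun U r ↦ ?_
  let : Algebra (D.eqSub U.1) (D.eqSub (S.basicOpen r)) :=
    (D.diagram.map (homOfLE (S.basicOpen_le r)).op).hom.toAlgebra
  let a : D.eqSub U.1 := ⟨D.π.app U.1 r, D.app_mem_eqSub _ _⟩
  change IsLocalization.Away a (D.eqSub (S.basicOpen r))
  let res (x : Γ(D.Y, D.π ⁻¹ᵁ U.1)) : Γ(D.Y, D.π ⁻¹ᵁ S.basicOpen r) :=
    D.Y.presheaf.map (homOfLE (D.π.preimage_mono (S.basicOpen_le r))).op x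
  have hres (x : D.eqSub U.1) : (algebraMap (D.eqSub U.1) (D.eqSub (S.basicOpen r)) x).1 =
    res x.1 := rfl
  have hnat {V : S.Opens} (h : V ≤ U.1) (x : Γ(D.Y, D.π ⁻¹ᵁ U.1)) :
      D.p.appLE _ (D.ρ ⁻¹ᵁ V) (D.le_p V) (D.Y.presheaf.map (homOfLE (D.π.preimage_mono h)).op x) =
      D.R.presheaf.map (homOfLE (D.ρ.preimage_mono h)).op (D.p.appLE _ _ (D.le_p _) x) ∧
      D.q.appLE _ (D.ρ ⁻¹ᵁ V) (D.le_q V) (D.Y.presheaf.map (homOfLE (D.π.preimage_mono h)).op x) =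
      D.R.presheaf.map (homOfLE (D.ρ.preimage_mono h)).op (D.q.appLE _ _ (D.le_q _) x) := by
    simp only [← CommRingCat.comp_apply, Scheme.Hom.map_appLE, Scheme.Hom.appLE_map, and_self]
  have hp (x : Γ(S, U.1)) : D.p.appLE _ _ (D.le_p _) (D.π.app U.1 x) = D.ρ.app U.1 x := by
    simp only [← CommRingCat.comp_apply, Scheme.Hom.app_eq_appLE, Scheme.Hom.appLE_comp_appLE, D.hp]
  have hq (x : Γ(S, U.1)) : D.q.appLE _ _ (D.le_q _) (D.π.app U.1 x) = D.ρ.app U.1 x := by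
    simp only [← CommRingCat.comp_apply, Scheme.Hom.app_eq_appLE, Scheme.Hom.appLE_comp_appLE, D.hq]
  refine IsLocalization.Away.mk a ?_ ?_ ?_
  · have h := (RingedSpace.isUnit_res_basicOpen S.toRingedSpace r).map
      (D.diagramMap.app (.op (S.basicOpen r))).hom
    have h2 := congr($(D.diagramMap.naturality (homOfLE (S.basicOpen_le r)).op) r)
    exact h2 ▸ h
  · intro x
    obtain ⟨n, y, hy⟩ := D.π.exists_pow_mul_eq_map U.2 r x.1
    have hy' : D.Y.presheaf.map (homOfLE (D.π.preimage_mono (S.basicOpen_le r))).op y ∈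
        D.eqSub (S.basicOpen r) := by
      rw [hy]
      exact (D.eqSub _).mul_mem ((D.eqSub _).pow_mem (D.map_mem_eqSub (S.basicOpen_le r) a.2) _) x.2
    -- The numerator `y` need not be invariant. Its two pullbacks to `R` agree over the basic open,
    -- so a further power `r ^ m` makes it invariant.
    obtain ⟨m, hm⟩ := D.ρ.exists_pow_mul_eq_zero U.2 r
      (D.p.appLE _ _ (D.le_p _) y - D.q.appLE _ _ (D.le_q _) y) (by
        rw [mem_eqSub, (hnat (S.basicOpen_le r) y).1, (hnat (S.basicOpen_le r) y).2] at hy'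
        rw [map_sub, hy', sub_self])
    refine ⟨m + n, ⟨D.π.app U.1 r ^ m * y, ?_⟩, Subtype.ext ?_⟩
    · rw [mem_eqSub, map_mul, map_mul, map_pow, map_pow, hp, hq]
      rwa [mul_sub, sub_eq_zero] at hm
    · rw [hres]
      simp only [res, map_mul, map_pow, hy]
      change x.1 * res a.1 ^ (m + n) = res a.1 ^ m * (res a.1 ^ n * x.1)
      ring
  · intro x y hxy
    have h0 : res (x.1 - y.1) = 0 := by
      have := congr($hxy.1)
      rw [hres, hres] at this
      simp only [res, map_sub] at this ⊢
      rw [this, sub_self]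
    obtain ⟨n, hn⟩ := D.π.exists_pow_mul_eq_zero U.2 r (x.1 - y.1) h0
    refine ⟨n, Subtype.ext ?_⟩
    rwa [mul_sub, sub_eq_zero] at hn

end
end ParallelOver
end EtaleProj

/-! ### The affine quotient as a relative spectrum -/

namespace EtaleProj
open Limits Scheme AffineZariskiSite
namespace ParallelOver

variable {S : Scheme.{u}} (D : ParallelOver S)
variable [QuasiCompact D.π] [QuasiSeparated D.π] [QuasiCompact D.ρ]

/-- The affine schemes that are glued to form the affine quotient. -/
def glueData := relativeGluingData D.coequifibered_diagramMap

instance : (D.glueData.functor ⋙ Scheme.forget).IsLocallyDirected :=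
  Cover.RelativeGluingData.instIsLocallyDirectedI₀CompFunctorForgetOfIsThin ..

/-- The affine quotient of `p, q : R ⟶ Y` over `S`: the relative spectrum of the equalizer of the
direct images of the structure sheaves of `Y` and `R`. -/
def quot : Scheme.{u} := D.glueData.glued

/-- The cover of the affine quotient by spectra of rings of invariant functions. -/
def quotCover : D.quot.OpenCover := D.glueData.cover

/-- The inclusion of the spectrum of the ring of invariant functions over an affine open. -/
def quotι (U : S.affineOpens) : Spec (.of (D.eqSub U.1)) ⟶ D.quot := D.quotCover.f U

instance (U : S.affineOpens) : IsOpenImmersion (D.quotι U) := D.quotCover.map_prop U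

/-- The quotient map. -/
def toQuot : D.Y ⟶ D.quot :=
  Scheme.OpenCover.glueMorphismsOfLocallyDirected
    ((directedCover S).pullback₁ D.π)
    (fun U ↦
      (pullbackRestrictIsoRestrict D.π _).hom ≫
      (D.π ⁻¹ᵁ U.1).toSpecΓ ≫ Spec.map (CommRingCat.ofHom (D.eqSub U.1).subtype)
        ≫ D.quotι U) fun {U V : S.AffineZariskiSite} i ↦ by
  -- The transition maps of the pulled back cover are the inclusions of preimages; with `h2`, this
  -- makes the local maps to spectra compatible.
  have h1 : (pullbackRestrictIsoRestrict D.π U.1).inv ≫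
      Cover.trans ((directedCover S).pullback₁ D.π) i ≫
      (pullbackRestrictIsoRestrict D.π V.1).hom = D.Y.homOfLE
        (D.π.preimage_mono (toOpens_mono i.1.1)) := by
    refine (cancel_mono (D.π ⁻¹ᵁ V.1).ι).mp ?_
    refine (Category.assoc _ _ _).trans ?_
    refine (Iso.inv_comp_eq _).mpr ?_
    refine (Category.assoc _ _ _).trans ?_
    refine (congrArg (Cover.trans ((directedCover S).pullback₁ D.π) i ≫ ·)
      (pullbackRestrictIsoRestrict_hom_ι D.π V.1)).trans ?_
    refine (pullback.lift_fst _ _ _).trans ?_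
    refine (Category.comp_id _).trans ?_
    rw [Scheme.homOfLE_ι]
    exact (pullbackRestrictIsoRestrict_hom_ι D.π U.1).symm
  have h2 : (D.π ⁻¹ᵁ U.1).toSpecΓ ≫ Spec.map (CommRingCat.ofHom (D.eqSub U.1).subtype) ≫
      D.quotι U = D.Y.homOfLE (D.π.preimage_mono (toOpens_mono i.1.1)) ≫
      (D.π ⁻¹ᵁ V.1).toSpecΓ ≫ Spec.map (CommRingCat.ofHom (D.eqSub V.1).subtype) ≫
      D.quotι V := by
    rw [← Scheme.Opens.toSpecΓ_SpecMap_presheaf_map_assoc]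
    refine congrArg ((D.π ⁻¹ᵁ U.1).toSpecΓ ≫ ·) ?_
    refine (congrArg (Spec.map (CommRingCat.ofHom (D.eqSub U.1).subtype) ≫ ·)
      (colimit.w D.glueData.functor i).symm).trans ?_
    refine (Category.assoc _ _ _).symm.trans (Eq.trans ?_ (Category.assoc _ _ _))
    refine congrArg (· ≫ D.quotι V) ?_
    refine (Spec.map_comp _ _).symm.trans (Eq.trans ?_ (Spec.map_comp _ _))
    rfl
  refine ((Iso.inv_comp_eq _).mp ?_)
  refine (Category.assoc _ _ _).symm.trans (((Category.assoc _ _ _).symm.trans ?_).trans h2.symm)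
  refine congrArg (· ≫ (D.π ⁻¹ᵁ V.1).toSpecΓ ≫
    Spec.map (CommRingCat.ofHom (D.eqSub V.1).subtype) ≫ D.quotι V) ?_
  exact (Category.assoc _ _ _).trans h1

lemma ι_toQuot (U : S.affineOpens) :
    (D.π ⁻¹ᵁ U.1).ι ≫ D.toQuot = (D.π ⁻¹ᵁ U.1).toSpecΓ ≫
      Spec.map (CommRingCat.ofHom (D.eqSub U.1).subtype) ≫ D.quotι U := by
  rw [← cancel_epi (pullbackRestrictIsoRestrict D.π U.1).hom, ← Category.assoc]
  trans ((directedCover S).pullback₁ D.π).f U ≫ D.toQuot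
  · exact congrArg (· ≫ D.toQuot) (pullbackRestrictIsoRestrict_hom_ι D.π U.1)
  delta toQuot
  generalize_proofs _ _ _ _ H
  exact Scheme.OpenCover.map_glueMorphismsOfLocallyDirected _ _ H _

/-- The structure morphism of the affine quotient. -/
def fromQuot : D.quot ⟶ S := D.glueData.toBase

lemma ι_fromQuot (U : S.affineOpens) :
    D.quotι U ≫ D.fromQuot =
      Spec.map (D.diagramMap.app (.op U.1)) ≫ U.2.fromSpec :=
  colimit.ι_desc _ _

lemma fromQuot_preimage (U : S.affineOpens) :
    D.fromQuot ⁻¹ᵁ U = (D.quotι U).opensRange := by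
  simpa using! D.glueData.toBase_preimage_eq_opensRange_ι U

@[simp]
lemma toQuot_fromQuot : D.toQuot ≫ D.fromQuot = D.π := by
  refine Scheme.Cover.hom_ext (D.Y.openCoverOfIsOpenCover _
    (.comap (iSup_affineOpens_eq_top S) D.π.base.1)) _ _ fun (U : S.affineOpens) ↦ ?_
  change (D.π ⁻¹ᵁ U.1).ι ≫ _ = (D.π ⁻¹ᵁ U.1).ι ≫ _
  refine (reassoc_of% D.ι_toQuot U) _ |>.trans ?_
  have h1 : Spec.map (CommRingCat.ofHom (D.eqSub U.1).subtype) ≫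
      Spec.map (D.diagramMap.app (.op U.1)) = Spec.map (D.π.app U.1) := (Spec.map_comp _ _).symm
  have hU : IsAffineOpen U.1 := U.2
  have h2 : (D.π ⁻¹ᵁ U.1).toSpecΓ ≫ Spec.map (D.π.app U.1) ≫ hU.fromSpec =
      (D.π ⁻¹ᵁ U.1).ι ≫ D.π := by
    rw [Scheme.Hom.app_eq_appLE, Scheme.Opens.toSpecΓ_SpecMap_appLE_assoc,
      IsAffineOpen.toSpecΓ_fromSpec, Scheme.Hom.resLE_comp_ι]
  refine Eq.trans ?_ h2
  refine congrArg ((D.π ⁻¹ᵁ U.1).toSpecΓ ≫ ·) ?_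
  refine (congrArg (Spec.map (CommRingCat.ofHom (D.eqSub U.1).subtype) ≫ ·)
    (D.ι_fromQuot U)).trans ?_
  exact (Category.assoc _ _ _).symm.trans (congrArg (· ≫ hU.fromSpec) h1)

instance : IsAffineHom D.fromQuot := by
  refine isAffineHom_of_forall_exists_isAffineOpen _ fun x ↦ ?_
  obtain ⟨U, hxU⟩ := TopologicalSpace.Opens.mem_iSup.mp
    ((iSup_affineOpens_eq_top S).symm ▸ TopologicalSpace.Opens.mem_top x)
  refine ⟨U.1, hxU, U.2, ?_⟩
  rw [D.fromQuot_preimage U]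
  exact isAffineOpen_opensRange (D.quotι U)

lemma isIso_appLE_of_eq_opensRange {X Y : Scheme.{u}} (j : X ⟶ Y) [IsOpenImmersion j]
    {W : Y.Opens} (hW : W = j.opensRange) (e : ⊤ ≤ j ⁻¹ᵁ W) : IsIso (j.appLE W ⊤ e) := by
  obtain rfl : W = j ''ᵁ ⊤ := hW.trans j.image_top_eq_opensRange.symm
  rw [← Scheme.Hom.appIso_hom']
  infer_instance

lemma appLE_comp_comp {A B C Z : Scheme.{u}} (f₁ : A ⟶ B) (f₂ : B ⟶ C) (f₃ : C ⟶ Z) {g : A ⟶ Z}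
    (hg : g = f₁ ≫ f₂ ≫ f₃) {W : Z.Opens} (e : ⊤ ≤ f₃ ⁻¹ᵁ W) (e' : ⊤ ≤ g ⁻¹ᵁ W)
    (e₁ : ⊤ ≤ f₁ ⁻¹ᵁ ⊤) (e₂ : ⊤ ≤ f₂ ⁻¹ᵁ ⊤) : g.appLE W ⊤ e' =
    f₃.appLE W ⊤ e ≫ f₂.appLE ⊤ ⊤ e₂ ≫ f₁.appLE ⊤ ⊤ e₁ := by
  subst hg
  rw [Scheme.Hom.appLE_comp_appLE, Scheme.Hom.appLE_comp_appLE]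
  simp only [Category.assoc]

/-- The sections of the affine quotient on the preimage of an affine open are the invariant
functions. -/
def quotObjIso {U : S.Opens} (hU : IsAffineOpen U) :
    Γ(D.quot, D.fromQuot ⁻¹ᵁ U) ≅ .of (D.eqSub U) :=
  have h := D.fromQuot_preimage ⟨U, hU⟩
  have := isIso_appLE_of_eq_opensRange (D.quotι ⟨U, hU⟩) h (by
    rw [h, Scheme.Hom.preimage_opensRange])
  asIso ((D.quotι ⟨U, hU⟩).appLE _ ⊤ _) ≪≫ Scheme.ΓSpecIso _

/-- Identifies pullback of functions along the quotient map with the inclusion of the invariant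
functions. This is how the equalizer property enters the base change argument. -/
lemma quotObjIso_hom_subtype {U : S.Opens} (hU : IsAffineOpen U) :
    (D.quotObjIso hU).hom ≫ CommRingCat.ofHom (D.eqSub U).subtype =
    D.toQuot.appLE _ _ (by rw [← Scheme.Hom.comp_preimage, toQuot_fromQuot]) := by
  have h1 : (D.π ⁻¹ᵁ U).toSpecΓ.appLE ⊤ ⊤ le_top = (ΓSpecIso _).hom ≫
      (D.π ⁻¹ᵁ U).ι.appLE (D.π ⁻¹ᵁ U) ⊤ (by simp) := by
    refine (Scheme.Hom.app_eq_appLE _).symm.trans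
      ((Scheme.Opens.toSpecΓ_appTop (D.π ⁻¹ᵁ U)).trans ?_)
    rw [Scheme.Opens.ι_appLE]
    rfl
  have h2 : IsIso ((D.π ⁻¹ᵁ U).ι.appLE (D.π ⁻¹ᵁ U) ⊤ (by simp)) :=
    isIso_appLE_of_eq_opensRange _ (by simp) _
  rw [← cancel_mono ((D.π ⁻¹ᵁ U).ι.appLE (D.π ⁻¹ᵁ U) ⊤ (by simp))]
  have h4 : ⊤ ≤ D.quotι ⟨U, hU⟩ ⁻¹ᵁ D.fromQuot ⁻¹ᵁ U := by
    rw [D.fromQuot_preimage ⟨U, hU⟩, Scheme.Hom.preimage_opensRange]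
  have h5 : (Spec.map (CommRingCat.ofHom (D.eqSub U).subtype)).appLE ⊤ ⊤ le_top ≫
      (ΓSpecIso Γ(D.Y, D.π ⁻¹ᵁ U)).hom =
      (ΓSpecIso (.of (D.eqSub U))).hom ≫ CommRingCat.ofHom (D.eqSub U).subtype := by
    rw [← ΓSpecIso_naturality]
    exact congrArg (· ≫ (ΓSpecIso Γ(D.Y, D.π ⁻¹ᵁ U)).hom) (Scheme.Hom.app_eq_appLE _).symm
  have h6 : (D.toQuot).appLE (D.fromQuot ⁻¹ᵁ U) (D.π ⁻¹ᵁ U) (by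
      rw [← Scheme.Hom.comp_preimage, toQuot_fromQuot]) ≫
        (D.π ⁻¹ᵁ U).ι.appLE (D.π ⁻¹ᵁ U) ⊤ (by simp) =
      (D.quotι ⟨U, hU⟩).appLE (D.fromQuot ⁻¹ᵁ U) ⊤ h4 ≫
        (Spec.map (CommRingCat.ofHom (D.eqSub U).subtype)).appLE ⊤ ⊤ le_top ≫
        (D.π ⁻¹ᵁ U).toSpecΓ.appLE ⊤ ⊤ le_top := by
    rw [Scheme.Hom.appLE_comp_appLE]
    exact appLE_comp_comp _ _ _ (D.ι_toQuot ⟨U, hU⟩) h4 _ _ _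
  refine Eq.trans ?_ h6.symm
  rw [h1, reassoc_of% h5]
  simp only [quotObjIso, Iso.trans_hom, asIso_hom, Category.assoc]

/-- The quotient map is invariant. -/
lemma p_toQuot : D.p ≫ D.toQuot = D.q ≫ D.toQuot := by
  refine Scheme.Cover.hom_ext (D.R.openCoverOfIsOpenCover _
    (.comap (iSup_affineOpens_eq_top S) D.ρ.base.1)) _ _ fun (U : S.affineOpens) ↦ ?_
  change (D.ρ ⁻¹ᵁ U.1).ι ≫ _ = (D.ρ ⁻¹ᵁ U.1).ι ≫ _
  have h (f : D.R ⟶ D.Y) (hf : D.ρ ⁻¹ᵁ U.1 ≤ f ⁻¹ᵁ D.π ⁻¹ᵁ U.1) :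
      (D.ρ ⁻¹ᵁ U.1).ι ≫ f ≫ D.toQuot = (D.ρ ⁻¹ᵁ U.1).toSpecΓ ≫ Spec.map (f.appLE _ _ hf) ≫
        Spec.map (CommRingCat.ofHom (D.eqSub U.1).subtype) ≫ D.quotι U := by
    rw [Scheme.Opens.toSpecΓ_SpecMap_appLE_assoc, ← ι_toQuot, Scheme.Hom.resLE_comp_ι_assoc]
  have h' : Spec.map (D.p.appLE _ _ (D.le_p U.1)) ≫
      Spec.map (CommRingCat.ofHom (D.eqSub U.1).subtype) = Spec.map (D.q.appLE _ _ (D.le_q U.1)) ≫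
      Spec.map (CommRingCat.ofHom (D.eqSub U.1).subtype) := by
    rw [← Spec.map_comp, ← Spec.map_comp]
    congr 1
    ext x
    exact x.2
  exact (h _ (D.le_p U.1)).trans (congr((D.ρ ⁻¹ᵁ U.1).toSpecΓ ≫ $h' ≫ D.quotι U).trans
    (h _ (D.le_q U.1)).symm)

end ParallelOver
end EtaleProj

/-! ### Flat base change of the affine quotient -/

namespace EtaleProj
open Limits Scheme

open TensorProduct in
/-- Equalizers of ring homomorphisms commute with flat base change. -/
lemma existsUnique_of_isPushout_of_flat {A B C D E C' D' E' : CommRingCat.{u}}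
    {a : A ⟶ B} (ha : a.hom.Flat) {c : A ⟶ C} {d : A ⟶ D} {e : A ⟶ E} {f g : C ⟶ D} {i : E ⟶ C}
    (hf : c ≫ f = d) (hg : c ≫ g = d) (he : e ≫ i = c)
    (hi : Function.Injective i) (hifg : ∀ x, f x = g x → ∃ y, i y = x)
    (hfg : i ≫ f = i ≫ g)
    {c₁ : C ⟶ C'} {c₂ : B ⟶ C'} (hC : IsPushout c a c₁ c₂)
    {d₁ : D ⟶ D'} {d₂ : B ⟶ D'} (hD : IsPushout d a d₁ d₂)
    {e₁ : E ⟶ E'} {e₂ : B ⟶ E'} (hE : IsPushout e a e₁ e₂)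
    {f' g' : C' ⟶ D'} {i' : E' ⟶ C'}
    (hf₁ : c₁ ≫ f' = f ≫ d₁) (hf₂ : c₂ ≫ f' = d₂)
    (hg₁ : c₁ ≫ g' = g ≫ d₁) (hg₂ : c₂ ≫ g' = d₂)
    (hi₁ : e₁ ≫ i' = i ≫ c₁) (hi₂ : e₂ ≫ i' = c₂) (w : C') (hw : f' w = g' w) :
    ∃! z, i' z = w := by
  algebraize [a.hom, c.hom, d.hom, e.hom, c₁.hom, c₂.hom, d₁.hom, d₂.hom, e₁.hom, e₂.hom,
    (c ≫ c₁).hom, (d ≫ d₁).hom, (e ≫ e₁).hom]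
  have : IsScalarTower A B C' := .of_algebraMap_eq' congr(($hC.w).hom)
  have : IsScalarTower A B D' := .of_algebraMap_eq' congr(($hD.w).hom)
  have : IsScalarTower A B E' := .of_algebraMap_eq' congr(($hE.w).hom)
  have : IsScalarTower A C C' := .of_algebraMap_eq' rfl
  have : IsScalarTower A D D' := .of_algebraMap_eq' rfl
  have : IsScalarTower A E E' := .of_algebraMap_eq' rfl
  have bC := ((CommRingCat.isPushout_iff_isPushout ..).mp hC.flip).out
  have bD := ((CommRingCat.isPushout_iff_isPushout ..).mp hD.flip).out
  have bE := ((CommRingCat.isPushout_iff_isPushout ..).mp hE.flip).out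
  -- Viewed `A`-linearly, `f'`, `g'` and `i'` become the base changes of `f`, `g` and `i` to `B`, as
  -- is checked on pure tensors.
  let φ : C →ₗ[A] D := (AlgHom.mk f.hom fun r ↦ congr(($hf).hom r)).toLinearMap
  let γ : C →ₗ[A] D := (AlgHom.mk g.hom fun r ↦ congr(($hg).hom r)).toLinearMap
  let ι : E →ₗ[A] C := (AlgHom.mk i.hom fun r ↦ congr(($he).hom r)).toLinearMap
  have hφ (x : B ⊗[A] C) : f' (bC.equiv x) = bD.equiv (φ.lTensor B x) := by
    induction x with
    | zero => simp
    | add x y hx hy => simp [hx, hy]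
    | tmul b x =>
      rw [LinearMap.lTensor_tmul, IsBaseChange.equiv_tmul, IsBaseChange.equiv_tmul,
        Algebra.smul_def, map_mul, Algebra.smul_def]
      exact congr($(congr(($hf₂).hom b)) * $(congr(($hf₁).hom x)))
  have hγ (x : B ⊗[A] C) : g' (bC.equiv x) = bD.equiv (γ.lTensor B x) := by
    induction x with
    | zero => simp
    | add x y hx hy => simp [hx, hy]
    | tmul b x =>
      rw [LinearMap.lTensor_tmul, IsBaseChange.equiv_tmul, IsBaseChange.equiv_tmul,
        Algebra.smul_def, map_mul, Algebra.smul_def]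
      exact congr($(congr(($hg₂).hom b)) * $(congr(($hg₁).hom x)))
  have hι (x : B ⊗[A] E) : i' (bE.equiv x) = bC.equiv (ι.lTensor B x) := by
    induction x with
    | zero => simp
    | add x y hx hy => simp [hx, hy]
    | tmul b x =>
      rw [LinearMap.lTensor_tmul, IsBaseChange.equiv_tmul, IsBaseChange.equiv_tmul,
        Algebra.smul_def, map_mul, Algebra.smul_def]
      exact congr($(congr(($hi₂).hom b)) * $(congr(($hi₁).hom x)))
  have hinj : Function.Injective i' := by
    have h := Module.Flat.lTensor_preserves_injective_linearMap (M := B) ι hi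
    intro x y hxy
    obtain ⟨x, rfl⟩ := bE.equiv.surjective x
    obtain ⟨y, rfl⟩ := bE.equiv.surjective y
    rw [hι, hι] at hxy
    rw [h (bC.equiv.injective hxy)]
  -- The equalizer is the kernel of the difference, and tensoring with the flat module `B` preserves
  -- exactness.
  have hex : Function.Exact ι (φ - γ) := by
    intro x
    rw [LinearMap.sub_apply, sub_eq_zero]
    refine ⟨hifg x, ?_⟩
    rintro ⟨y, rfl⟩
    exact congr(($hfg).hom y)
  have hex' := Module.Flat.lTensor_exact B hex
  obtain ⟨w, rfl⟩ := bC.equiv.surjective w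
  rw [hφ, hγ] at hw
  obtain ⟨z, hz⟩ := (hex' w).mp (by
    rw [LinearMap.lTensor_sub, LinearMap.sub_apply, bD.equiv.injective hw, sub_self])
  exact ⟨bE.equiv z, by dsimp only; rw [hι, hz], fun y hy ↦ hinj (hy.trans (by rw [hι, hz]))⟩

namespace ParallelOver

variable {S : Scheme.{u}} (D : ParallelOver S)
variable [QuasiCompact D.π] [QuasiSeparated D.π] [QuasiCompact D.ρ] [QuasiSeparated D.ρ]

section

variable {T YT RT QT : Scheme.{u}} {g : T ⟶ S} [Flat g] [IsAffine T]
  {V : S.Opens} (hV : IsAffineOpen V) (hTV : ⊤ ≤ g ⁻¹ᵁ V)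
  {gY : YT ⟶ D.Y} {iY : YT ⟶ T} (HY : IsPullback gY iY D.π g)
  {gR : RT ⟶ D.R} {iR : RT ⟶ T} (HR : IsPullback gR iR D.ρ g)
  {gQ : QT ⟶ D.quot} {iQ : QT ⟶ T} (HQ : IsPullback gQ iQ D.fromQuot g)
  {pT qT : RT ⟶ YT} {tT : YT ⟶ QT}
  (hp₁ : pT ≫ gY = gR ≫ D.p) (hp₂ : pT ≫ iY = iR)
  (hq₁ : qT ≫ gY = gR ≫ D.q) (hq₂ : qT ≫ iY = iR)
  (ht₁ : tT ≫ gQ = gY ≫ D.toQuot) (ht₂ : tT ≫ iQ = iY)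

include hV hTV HY HR HQ hp₁ hp₂ hq₁ hq₂ ht₁ ht₂

/-- The formation of the affine quotient commutes with flat base change. -/
lemma existsUnique_appTop_eq (w : Γ(YT, ⊤)) (hw : pT.appTop w = qT.appTop w) :
    ∃! z : Γ(QT, ⊤), tT.appTop z = w := by
  have hT : IsAffineOpen (⊤ : T.Opens) := isAffineOpen_top T
  have appTop_eq {Z Z' : Scheme.{u}} (f : Z ⟶ Z') : f.appTop =
      f.appLE ⊤ ⊤ (show ⊤ ≤ f ⁻¹ᵁ ⊤ from le_top) := by
    simpa [Scheme.Hom.appLE] using! (Category.comp_id (f.app ⊤)).symm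
  have top_eq {Z ZT : Scheme.{u}} {f : Z ⟶ S} {gZ : ZT ⟶ Z} {iZ : ZT ⟶ T}
      (H : IsPullback gZ iZ f g) : (⊤ : ZT.Opens) = gZ ⁻¹ᵁ f ⁻¹ᵁ V ⊓ iZ ⁻¹ᵁ ⊤ := by
    rw [← Scheme.Hom.comp_preimage, H.w, Scheme.Hom.comp_preimage, top_le_iff.mp hTV]
    simp
  -- For `Y` and `R`, sections commute with base change because `g` is flat and the structure
  -- morphisms are quasi-compact and quasi-separated; for the quotient, because it is affine over
  -- `S`.
  have hC := (isIso_pushoutSection_iff HY hTV le_rfl (top_eq HY)).mp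
    (isIso_pushoutSection_of_isQuasiSeparated_of_flat_right HY hTV le_rfl (top_eq HY) hV hT
      (D.π.isCompact_preimage hV.isCompact) (D.π.isQuasiSeparated_preimage hV.isQuasiSeparated))
  have hD := (isIso_pushoutSection_iff HR hTV le_rfl (top_eq HR)).mp
    (isIso_pushoutSection_of_isQuasiSeparated_of_flat_right HR hTV le_rfl (top_eq HR) hV hT
      (D.ρ.isCompact_preimage hV.isCompact) (D.ρ.isQuasiSeparated_preimage hV.isQuasiSeparated))
  have hE := (isIso_pushoutSection_iff HQ hTV le_rfl (top_eq HQ)).mp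
    (isIso_pushoutSection_of_isAffineOpen HQ hTV le_rfl (top_eq HQ) hV hT
      (hV.preimage D.fromQuot))
  have hle : D.π ⁻¹ᵁ V ≤ D.toQuot ⁻¹ᵁ D.fromQuot ⁻¹ᵁ V := by simp [← Scheme.Hom.comp_preimage]
  have hi := D.quotObjIso_hom_subtype hV
  refine existsUnique_of_isPushout_of_flat (g.flat_appLE hV hT hTV)
    (f := D.p.appLE _ _ (D.le_p V)) (g := D.q.appLE _ _ (D.le_q V))
    (i := D.toQuot.appLE _ _ hle) ?_ ?_ ?_ ?_ ?_ ?_ hC hD hE (f' := pT.appTop) (g' := qT.appTop)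
    ?_ ?_ ?_ ?_ ?_ ?_ w hw
  · simp [Scheme.Hom.appLE_comp_appLE, D.hp]
  · simp [Scheme.Hom.appLE_comp_appLE, D.hq]
  · simp [Scheme.Hom.appLE_comp_appLE]
  · rw [← hi]
    exact Subtype.val_injective.comp
      (ConcreteCategory.bijective_of_isIso (D.quotObjIso hV).hom).injective
  · intro x hx
    obtain ⟨y, hy⟩ := (ConcreteCategory.bijective_of_isIso (D.quotObjIso hV).hom).surjective ⟨x, hx⟩
    refine ⟨y, ?_⟩
    rw [← hi]
    exact congr($(hy).1)
  · rw [← hi, Category.assoc, Category.assoc]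
    congr 1
    ext x
    exact x.2
  all_goals rw [appTop_eq]; simp [Scheme.Hom.appLE_comp_appLE, *]

/-- After flat base change to an affine scheme, the affine quotient is a coequalizer among affine
schemes. -/
lemma existsUnique_comp_eq {N : Scheme.{u}} [IsAffine N] (r : YT ⟶ N) (hr : pT ≫ r = qT ≫ r) :
    ∃! k : QT ⟶ N, tT ≫ k = r := by
  have key := D.existsUnique_appTop_eq hV hTV HY HR HQ hp₁ hp₂ hq₁ hq₂ ht₁ ht₂
  have hrx (x : Γ(N, ⊤)) : pT.appTop (r.appTop x) = qT.appTop (r.appTop x) := by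
    simp only [← CommRingCat.comp_apply, ← Scheme.Hom.comp_appTop, hr]
  have hpq : pT ≫ tT = qT ≫ tT := by
    apply HQ.hom_ext
    · simp only [Category.assoc, ht₁, reassoc_of% hp₁, reassoc_of% hq₁, D.p_toQuot]
    · simp only [Category.assoc, ht₂, hp₂, hq₂]
  have htx (x : Γ(QT, ⊤)) : pT.appTop (tT.appTop x) = qT.appTop (tT.appTop x) := by
    simp only [← CommRingCat.comp_apply, ← Scheme.Hom.comp_appTop, hpq]
  have hinj : Function.Injective tT.appTop := fun x y hxy ↦
    (key (tT.appTop y) (htx y)).unique hxy rfl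
  -- Functions on `QT` are identified with their image in functions on `YT`; this image contains all
  -- pullbacks of functions along the invariant map `r`.
  let e := RingEquiv.ofBijective tT.appTop.hom.rangeRestrict
    ⟨fun x y hxy ↦ hinj (Subtype.ext_iff.mp hxy), tT.appTop.hom.rangeRestrict_surjective⟩
  let ψ : Γ(N, ⊤) ⟶ Γ(QT, ⊤) := CommRingCat.ofHom (e.symm.toRingHom.comp
    (r.appTop.hom.codRestrict _ fun x ↦ (key _ (hrx x)).exists))
  have hψ : ψ ≫ tT.appTop = r.appTop := by
    ext x
    exact congr($(e.apply_symm_apply ⟨r.appTop x, _⟩).1)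
  have hk : tT ≫ QT.toSpecΓ ≫ Spec.map ψ ≫ N.isoSpec.inv = r := by
    rw [Scheme.toSpecΓ_naturality_assoc, ← Spec.map_comp_assoc, hψ,
      ← Scheme.toSpecΓ_naturality_assoc, Scheme.toSpecΓ_isoSpec_inv, Category.comp_id]
  refine ⟨_, hk, fun k' hk' ↦ ext_of_isAffine ?_⟩
  have h := congr(($(hk'.trans hk.symm)).appTop)
  rw [Scheme.Hom.comp_appTop, Scheme.Hom.comp_appTop] at h
  ext x
  exact hinj congr($h x)

end

end ParallelOver

end EtaleProj

/-! ### Gluing on the small étale site -/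

namespace EtaleProj
open Limits Scheme

variable {U : Scheme.{u}}

/-- Every étale covering is an fppf covering, and the fppf topology is subcanonical. -/
instance : (Scheme.etaleTopology.{u}).Subcanonical := by
  refine .of_le (K := Scheme.fppfTopology) ?_
  refine Precoverage.toGrothendieck_mono (precoverage_mono fun X Y f hf ↦ ?_)
  exact ⟨inferInstance, inferInstance⟩

instance : IsZariskiLocalAtSource @Etale := HasRingHomProperty.instIsZariskiLocalAtSource

instance : MorphismProperty.RespectsIso @Etale :=
  Etale.etale_isStableUnderBaseChange.respectsIso

lemma isContinuous_etaleForget :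
    (Etale.forget U).IsContinuous U.smallEtaleTopology (U.overGrothendieckTopology @Etale) := by
  have h : CoverPreserving U.smallEtaleTopology (U.overGrothendieckTopology @Etale)
      (Etale.forget U) :=
    @Functor.coverPreserving_restrictedTopology _ _ _ _ (Etale.forget U) _
      (instLocallyCoverDenseOverTopMorphismPropertyOverForgetOverGrothendieckTopology ..)
      inferInstance inferInstance
  have : RepresentablyFlat (Etale.forget U) := flat_of_preservesFiniteLimits _
  exact Functor.isContinuous_of_coverPreserving (compatiblePreservingOfFlat _ _) h

/-- Inherited from the big étale site over `U` through a continuous, fully faithful inclusion. -/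
instance : U.smallEtaleTopology.Subcanonical := by
  have := isContinuous_etaleForget (U := U)
  have : (U.overGrothendieckTopology @Etale).Subcanonical :=
    inferInstanceAs (etaleTopology.over U).Subcanonical
  exact GrothendieckTopology.subcanonical_of_full_of_faithful (Etale.forget U) _
    (U.overGrothendieckTopology @Etale)

lemma isSheaf_yoneda (Q : U.Etale) : Presieve.IsSheaf U.smallEtaleTopology (yoneda.obj Q) :=
  GrothendieckTopology.Subcanonical.isSheaf_of_isRepresentable _

section

variable {G : U.Etaleᵒᵖ ⥤ Type*} (hG : Presieve.IsSheaf U.smallEtaleTopology G)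

lemma ofArrows_mem {ι : Type*} {T : U.Etale} {W : ι → U.Etale} (g : ∀ i, W i ⟶ T)
    (hg : ∀ x : T.left, ∃ i, x ∈ Set.range (g i).left) :
    Sieve.ofArrows W g ∈ U.smallEtaleTopology T := by
  rw [ofArrows_mem_smallEtaleTopology_iff]
  exact Set.eq_univ_of_forall fun x ↦ Set.mem_iUnion.mpr (hg x)

include hG

/-- Sections of an étale sheaf that agree locally are equal. -/
lemma section_ext {T : U.Etale} (a b : G.obj (op T))
    (h : ∀ x : T.left, ∃ (W : U.Etale) (g : W ⟶ T), x ∈ Set.range g.left ∧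
      G.map g.op a = G.map g.op b) : a = b := by
  choose W g hx hab using h
  refine ((hG _ (ofArrows_mem g fun x ↦ ⟨x, hx x⟩)).isSeparatedFor).ext ?_
  rintro Z f ⟨_, h, _, ⟨x⟩, rfl⟩
  rw [op_comp, Functor.map_comp, ConcreteCategory.comp_apply, ConcreteCategory.comp_apply, hab]

/-- Compatible families of sections of an étale sheaf can be glued. -/
lemma exists_section_of_compatible {ι : Type*} {T : U.Etale} {W : ι → U.Etale}
    (g : ∀ i, W i ⟶ T) (hg : ∀ x : T.left, ∃ i, x ∈ Set.range (g i).left)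
    (s : ∀ i, G.obj (op (W i)))
    (hs : ∀ i j (Z : U.Etale) (a : Z ⟶ W i) (b : Z ⟶ W j), a ≫ g i = b ≫ g j →
      G.map a.op (s i) = G.map b.op (s j)) :
    ∃ t : G.obj (op T), ∀ i, G.map (g i).op t = s i := by
  have h := hG _ (ofArrows_mem g hg)
  rw [Sieve.ofArrows, ← Presieve.isSheafFor_iff_generate, Presieve.isSheafFor_arrows_iff] at h
  exact (h s hs).exists

/-- A local condition on sections that determines them uniquely and can be satisfied locally can be
satisfied globally. -/
lemma exists_section_of_unique {T : U.Etale} (P : ∀ ⦃W : U.Etale⦄, (W ⟶ T) → G.obj (op W) → Prop)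
    (hP : ∀ {W W' : U.Etale} (f : W' ⟶ W) (g : W ⟶ T) (s), P g s → P (f ≫ g) (G.map f.op s))
    (huniq : ∀ {W : U.Etale} (g : W ⟶ T) (s s'), P g s → P g s' → s = s')
    (hex : ∀ x : T.left, ∃ (W : U.Etale) (g : W ⟶ T) (s : _), x ∈ Set.range g.left ∧ P g s) :
    ∃ t : G.obj (op T), ∀ x : T.left, ∃ (W : U.Etale) (g : W ⟶ T), x ∈ Set.range g.left ∧
      P g (G.map g.op t) := by
  choose W g s hx hs using hex
  obtain ⟨t, ht⟩ := exists_section_of_compatible hG g (fun x ↦ ⟨x, hx x⟩) s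
    fun i j Z a b hab ↦ huniq (a ≫ g i) _ _ (hP a _ _ (hs i)) (hab ▸ hP b _ _ (hs j))
  exact ⟨t, fun x ↦ ⟨W x, g x, hx x, by rw [ht]; exact hs x⟩⟩

/-- The empty family covers an empty scheme. -/
lemma section_subsingleton {T : U.Etale} (hT : IsEmpty T.left) : Subsingleton (G.obj (op T)) :=
  ⟨fun a b ↦ section_ext hG a b fun x ↦ hT.elim x⟩

end

/-- An étale `T`-scheme, as an object of the étale site of `U`. -/
def etOver (T : U.Etale) {W : Scheme.{u}} (w : W ⟶ T.left) [Etale w] : U.Etale :=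
  Etale.mk (w ≫ T.hom)

/-- Construct a morphism in the étale site. -/
def homMk {T T' : U.Etale} (f : T.left ⟶ T'.left) (hf : f ≫ T'.hom = T.hom) : T ⟶ T' :=
  MorphismProperty.Over.homMk f hf

@[simp] lemma left_hom {T T' : U.Etale} (f : T ⟶ T') :
    f.left ≫ T'.hom = T.hom :=
  CategoryTheory.Over.w ((Scheme.Etale.forget _).map f)

@[simp] lemma comp_left' {T T' T'' : U.Etale} (f : T ⟶ T') (g : T' ⟶ T'') :
    (f ≫ g).left = f.left ≫ g.left := rfl

@[ext] lemma etale_hom_ext {T T' : U.Etale} {f g : T ⟶ T'} (h : f.left = g.left) : f = g :=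
  (Scheme.Etale.forget _).map_injective (CategoryTheory.Over.OverMorphism.ext h)

lemma etOver_hom (T : U.Etale) {W : Scheme.{u}} (w : W ⟶ T.left) [Etale w] :
    (etOver T w).hom = w ≫ T.hom := rfl

/-- The structure morphism of an étale `T`-scheme. -/
def etOverπ (T : U.Etale) {W : Scheme.{u}} (w : W ⟶ T.left) [Etale w] : etOver T w ⟶ T :=
  homMk w rfl

/-- Locally, a morphism to `B` lifts to an étale `B`-scheme at points in the image. -/
lemma exists_local_lift {A B T : U.Etale} (f : A ⟶ B) (v : T ⟶ B) (x : T.left)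
    (hx : v.left x ∈ Set.range f.left) :
    ∃ (W : U.Etale) (h : W ⟶ T) (w : W ⟶ A), x ∈ Set.range h.left ∧ h ≫ v = w ≫ f := by
  obtain ⟨y, hy⟩ := hx
  obtain ⟨z, hz, -⟩ := Scheme.Pullback.exists_preimage_pullback (f := v.left) (g := f.left) x y
    hy.symm
  refine ⟨etOver T (pullback.fst v.left f.left), etOverπ _ _,
    homMk (pullback.snd v.left f.left) ?_, ⟨z, hz⟩, ?_⟩
  · rw [etOver_hom, ← left_hom f, ← left_hom v, pullback.condition_assoc]
    rfl
  · ext1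
    exact pullback.condition

/-- The disjoint union of étale schemes. -/
def sig {ι : Type u} (X : ι → U.Etale) : U.Etale :=
  have : Etale (Sigma.desc fun i ↦ (X i).hom) :=
    IsZariskiLocalAtSource.sigmaDesc fun i ↦ (X i).prop
  Etale.mk (Sigma.desc fun i ↦ (X i).hom)

/-- The inclusion of a summand of a disjoint union. -/
def sigι {ι : Type u} (X : ι → U.Etale) (i : ι) : X i ⟶ sig X :=
  homMk (Sigma.ι (fun i ↦ (X i).left) i) (Sigma.ι_desc _ _)

lemma exists_mem_range_sigι {ι : Type u} (X : ι → U.Etale) (x : (sig X).left) :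
    ∃ i, x ∈ Set.range (sigι X i).left := by
  obtain ⟨y, hy⟩ := (sigmaOpenCover fun i ↦ (X i).left).covers x
  exact ⟨_, y, hy⟩

/-- Distinct summands are disjoint, so gluing over a disjoint union imposes no compatibility between
them. -/
lemma sigι_comp_eq {ι : Type u} (X : ι → U.Etale) {i j : ι} {Z : U.Etale} (a : Z ⟶ X i)
    (b : Z ⟶ X j) (hab : a ≫ sigι X i = b ≫ sigι X j) : IsEmpty Z.left ∨ i = j :=
  or_iff_not_imp_right.mpr fun h ↦ isEmpty_of_commSq_sigmaι_of_ne (g := fun i ↦ (X i).left)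
    (a := a.left) (b := b.left) ⟨congr(($hab).left)⟩ h

lemma sigι_cancel {ι : Type u} (X : ι → U.Etale) {i : ι} {Z : U.Etale} (a b : Z ⟶ X i)
    (hab : a ≫ sigι X i = b ≫ sigι X i) : a = b := by
  ext1
  have := congr(($hab).left)
  exact (cancel_mono (Sigma.ι (fun i ↦ (X i).left) i)).mp this

/-- Sections over the summands of a disjoint union glue. -/
lemma exists_section_sig {G : U.Etaleᵒᵖ ⥤ Type*} (hG : Presieve.IsSheaf U.smallEtaleTopology G)
    {ι : Type u} (X : ι → U.Etale) (s : ∀ i, G.obj (op (X i))) :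
    ∃ t : G.obj (op (sig X)), ∀ i, G.map (sigι X i).op t = s i := by
  refine exists_section_of_compatible hG _ (exists_mem_range_sigι X) s fun i j Z a b hab ↦ ?_
  obtain h | rfl := sigι_comp_eq X a b hab
  · exact (section_subsingleton hG h).elim _ _
  · rw [sigι_cancel X a b hab]

end EtaleProj

/-! ### Constant sheaves are represented by disjoint unions of copies -/

namespace EtaleProj
open Limits Scheme

variable {U : Scheme.{u}}

lemma yoneda_ext {T Q : U.Etale} (a b : T ⟶ Q)
    (h : ∀ x : T.left, ∃ (W : U.Etale) (g : W ⟶ T), x ∈ Set.range g.left ∧ g ≫ a = g ≫ b) :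
    a = b :=
  section_ext (isSheaf_yoneda Q) a b h

/-- The sections `σ s` of `G` over `X`, for `s : S`, exhibit the restriction of `G` to `X` as the
constant sheaf with value `S`. -/
structure IsConstData (G : U.Etaleᵒᵖ ⥤ Type u) (X : U.Etale) {S : Type u}
    (σ : S → G.obj (op X)) : Prop where
  exists_eq {T : U.Etale} (g : T ⟶ X) (a : G.obj (op T)) (x : T.left) :
    ∃ (W : U.Etale) (h : W ⟶ T) (s : S), x ∈ Set.range h.left ∧
      G.map h.op a = G.map (h ≫ g).op (σ s)
  -- Over an empty `T` all sections of a sheaf coincide, so `T` must be nonempty.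
  eq_of_map_eq {T : U.Etale} (g : T ⟶ X) (s s' : S) (hT : Nonempty T.left)
    (h : G.map g.op (σ s) = G.map g.op (σ s')) : s = s'

/-- The section `n` over `N ⟶ X` exhibits `N` as an object representing the restriction of `G`
to `X`. -/
def IsRelRep (G : U.Etaleᵒᵖ ⥤ Type u) {N X : U.Etale} (pr : N ⟶ X) (n : G.obj (op N)) : Prop :=
  ∀ ⦃T : U.Etale⦄ (g : T ⟶ X) (a : G.obj (op T)), ∃! h : T ⟶ N, h ≫ pr = g ∧ G.map h.op n = a

lemma IsRelRep.hom_ext {G : U.Etaleᵒᵖ ⥤ Type u} {N X : U.Etale} {pr : N ⟶ X} {n : G.obj (op N)}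
    (h : IsRelRep G pr n) {T : U.Etale} {a b : T ⟶ N} (hab : a ≫ pr = b ≫ pr)
    (hn : G.map a.op n = G.map b.op n) : a = b :=
  (h (b ≫ pr) (G.map b.op n)).unique ⟨hab, hn⟩ ⟨rfl, rfl⟩

lemma map_comp_op {G : U.Etaleᵒᵖ ⥤ Type u} {A B C : U.Etale} (f : A ⟶ B) (g : B ⟶ C)
    (c : G.obj (op C)) : G.map (f ≫ g).op c = G.map f.op (G.map g.op c) := by
  rw [op_comp, Functor.map_comp, ConcreteCategory.comp_apply]

lemma IsConstData.restrict {G : U.Etaleᵒᵖ ⥤ Type u} {X X' : U.Etale} {S : Type u}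
    {σ : S → G.obj (op X)} (h : IsConstData G X σ) (f : X' ⟶ X) :
    IsConstData G X' fun s ↦ G.map f.op (σ s) where
  exists_eq g a x := by
    obtain ⟨W, k, s, hx, hk⟩ := h.exists_eq (g ≫ f) a x
    exact ⟨W, k, s, hx, by rw [hk, ← map_comp_op, Category.assoc]⟩
  eq_of_map_eq g s s' hT hs := by
    rw [← map_comp_op, ← map_comp_op] at hs
    exact h.eq_of_map_eq (g ≫ f) s s' hT hs

/-- The disjoint union of copies of `X` indexed by `S`. -/
def copies (X : U.Etale) (S : Type u) : U.Etale := sig fun _ : S ↦ X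

/-- The inclusion of a summand. -/
def copiesι (X : U.Etale) {S : Type u} (s : S) : X ⟶ copies X S := sigι (fun _ : S ↦ X) s

/-- The projection of a disjoint union of copies of `X` onto `X`. -/
def copiesπ (X : U.Etale) (S : Type u) : copies X S ⟶ X :=
  homMk (Sigma.desc fun _ ↦ 𝟙 X.left) (by
    refine Sigma.hom_ext _ _ fun s ↦ ?_
    refine (Category.assoc _ _ _).symm.trans
      ((congrArg (· ≫ X.hom) (Sigma.ι_desc _ _)).trans ?_)
    exact (Category.id_comp _).trans (Sigma.ι_desc (fun _ : S ↦ X.hom) s).symm)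

lemma copiesι_π (X : U.Etale) {S : Type u} (s : S) : copiesι X s ≫ copiesπ X S = 𝟙 X := by
  ext1
  exact Sigma.ι_desc _ _

/-- Locally such a morphism lands in one copy, hence is determined by an index and its projection to
`X`. -/
lemma exists_comp_eq_copiesι {X T : U.Etale} {S : Type u} (h : T ⟶ copies X S) (x : T.left) :
    ∃ (W : U.Etale) (k : W ⟶ T) (s : S), x ∈ Set.range k.left ∧
      k ≫ h = (k ≫ h ≫ copiesπ X S) ≫ copiesι X s := by
  obtain ⟨s, hs⟩ := exists_mem_range_sigι (fun _ : S ↦ X) (h.left x)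
  obtain ⟨W, k, w, hx, hk⟩ := exists_local_lift (copiesι X s) h x hs
  refine ⟨W, k, s, hx, ?_⟩
  rw [reassoc_of% hk, copiesι_π, Category.comp_id, hk]

/-- A constant sheaf is represented by a disjoint union. -/
lemma IsConstData.exists_isRelRep {G : U.Etaleᵒᵖ ⥤ Type u}
    (hG : Presieve.IsSheaf U.smallEtaleTopology G) {X : U.Etale} {S : Type u}
    {σ : S → G.obj (op X)} (hσ : IsConstData G X σ) :
    ∃ n : G.obj (op (copies X S)), IsRelRep G (copiesπ X S) n := by
  obtain ⟨n, hn⟩ : ∃ n : G.obj (op (copies X S)), ∀ s, G.map (copiesι X s).op n = σ s :=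
    exists_section_sig hG (fun _ : S ↦ X) σ
  -- Near each point both morphisms land in single copies; equality of the pulled back sections
  -- forces the two indices to agree.
  have huniq {T : U.Etale} (h h' : T ⟶ copies X S) (hh : h ≫ copiesπ X S = h' ≫ copiesπ X S)
      (hhn : G.map h.op n = G.map h'.op n) : h = h' := by
    refine yoneda_ext _ _ fun x ↦ ?_
    obtain ⟨W, k, s, ⟨y, rfl⟩, hk⟩ := exists_comp_eq_copiesι h x
    obtain ⟨W', k', s', ⟨z, rfl⟩, hk'⟩ := exists_comp_eq_copiesι (k ≫ h') y
    have h1 : (k' ≫ k) ≫ h = (k' ≫ k ≫ h ≫ copiesπ X S) ≫ copiesι X s := by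
      rw [Category.assoc, hk]
      simp only [Category.assoc]
    have h2 : (k' ≫ k) ≫ h' = (k' ≫ k ≫ h ≫ copiesπ X S) ≫ copiesι X s' := by
      rw [Category.assoc, hk', hh]
      simp only [Category.assoc]
    have h3 : G.map ((k' ≫ k) ≫ h).op n = G.map ((k' ≫ k) ≫ h').op n := by
      rw [map_comp_op _ h, map_comp_op _ h', hhn]
    rw [h1, h2, map_comp_op _ (copiesι X s), map_comp_op _ (copiesι X s'), hn, hn] at h3
    obtain rfl := hσ.eq_of_map_eq _ s s' ⟨z⟩ h3
    exact ⟨W', k' ≫ k, ⟨z, rfl⟩, h1.trans h2.symm⟩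
  refine ⟨n, fun T g a ↦ ?_⟩
  have key : ∃ t : T ⟶ copies X S, ∀ x : T.left, ∃ (W : U.Etale) (g' : W ⟶ T),
      x ∈ Set.range g'.left ∧ (g' ≫ t) ≫ copiesπ X S = g' ≫ g ∧
        G.map (g' ≫ t).op n = G.map g'.op a := by
    refine exists_section_of_unique (isSheaf_yoneda (copies X S)) (T := T)
      (fun W g' (h : W ⟶ copies X S) ↦ h ≫ copiesπ X S = g' ≫ g ∧ G.map h.op n = G.map g'.op a)
      (fun {W W'} f g' s hs ↦ ?_) (fun {W} g' s s' hs hs' ↦ ?_) fun x ↦ ?_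
    · change (f ≫ s) ≫ copiesπ X S = (f ≫ g') ≫ g ∧ G.map (f ≫ s).op n = G.map (f ≫ g').op a
      rw [Category.assoc, hs.1, Category.assoc, map_comp_op, hs.2, map_comp_op]
      exact ⟨rfl, rfl⟩
    · exact huniq _ _ (hs.1.trans hs'.1.symm) (hs.2.trans hs'.2.symm)
    · obtain ⟨W, h, s, hx, hs⟩ := hσ.exists_eq g a x
      refine ⟨W, h, (h ≫ g) ≫ copiesι X s, hx, ?_, ?_⟩
      · rw [Category.assoc, copiesι_π, Category.comp_id]
      · rw [map_comp_op, hn, hs]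
  obtain ⟨t, ht⟩ := key
  refine ⟨t, ⟨yoneda_ext _ _ fun x ↦ ?_, section_ext hG _ _ fun x ↦ ?_⟩,
    fun t' ht' ↦ huniq _ _ ?_ ?_⟩
  · obtain ⟨W, g', hx, h1, -⟩ := ht x
    exact ⟨W, g', hx, by rw [← h1, Category.assoc]⟩
  · obtain ⟨W, g', hx, -, h1⟩ := ht x
    exact ⟨W, g', hx, by rw [← h1, map_comp_op]⟩
  · refine ht'.1.trans (yoneda_ext _ _ fun x ↦ ?_)
    obtain ⟨W, g', hx, h1, -⟩ := ht x
    exact ⟨W, g', hx, by rw [← h1, Category.assoc]⟩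
  · refine ht'.2.trans (section_ext hG _ _ fun x ↦ ?_)
    obtain ⟨W, g', hx, -, h1⟩ := ht x
    exact ⟨W, g', hx, by rw [← h1, map_comp_op]⟩
-- The disjoint union is the spectrum of `S → R`, a finite `R`-module.
lemma isFinite_sigmaDesc_id_spec (R : CommRingCat.{u}) (S : Type u) [Finite S] :
    IsFinite (Limits.Sigma.desc fun _ : S ↦ 𝟙 (Spec R)) := by
  have h : (Limits.Sigma.desc fun _ : S ↦ 𝟙 (Spec R)) = sigmaSpec (fun _ : S ↦ R) ≫
      Spec.map (CommRingCat.ofHom (algebraMap R (S → R))) := by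
    refine Sigma.hom_ext _ _ fun s ↦ ?_
    rw [Sigma.ι_desc, ι_sigmaSpec_assoc, ← Spec.map_comp, ← Spec.map_id]
    rfl
  have : IsFinite (Spec.map (CommRingCat.ofHom (algebraMap R (S → R)))) := by
    rw [IsFinite.SpecMap_iff]
    exact RingHom.finite_algebraMap.mpr inferInstance
  rw [h]
  infer_instance

lemma isFinite_sigmaDesc_id (X : Scheme.{u}) [IsAffine X] (S : Type u) [Finite S] :
    IsFinite (Limits.Sigma.desc fun _ : S ↦ 𝟙 X) := by
  have h : (Limits.Sigma.desc fun _ : S ↦ 𝟙 X) = Limits.Sigma.map (fun _ ↦ X.isoSpec.hom) ≫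
      (Limits.Sigma.desc fun _ : S ↦ 𝟙 (Spec Γ(X, ⊤))) ≫ X.isoSpec.inv := by
    refine Sigma.hom_ext _ _ fun s ↦ ?_
    simp
  have := isFinite_sigmaDesc_id_spec Γ(X, ⊤) S
  rw [h]
  infer_instance

instance isFinite_copiesπ (X : U.Etale) [IsAffine X.left] (S : Type u) [Finite S] :
    IsFinite (copiesπ X S).left :=
  isFinite_sigmaDesc_id X.left S

end EtaleProj

/-! ### The relation defined by a section, and its quotient -/

namespace EtaleProj
open Limits Scheme

variable {U : Scheme.{u}}

lemma map_id_op {G : U.Etaleᵒᵖ ⥤ Type u} {T : U.Etale} (a : G.obj (op T)) :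
    G.map (𝟙 T).op a = a := by
  simp

lemma isOpenImmersion_ι {X : Scheme.{u}} (O : X.Opens) : IsOpenImmersion O.ι := inferInstance

lemma exists_lift_ι {X T : Scheme.{u}} (O : X.Opens) (f : T ⟶ X) (h : Set.range f ⊆ O) :
    ∃ l : T ⟶ O, l ≫ O.ι = f :=
  ⟨IsOpenImmersion.lift O.ι f (by rwa [Scheme.Opens.range_ι]), IsOpenImmersion.lift_fac _ _ _⟩

/-- Two sections of a sheaf on the small étale site agree exactly over an open subscheme. -/
lemma exists_eqLocus {G : U.Etaleᵒᵖ ⥤ Type u} (hG : Presieve.IsSheaf U.smallEtaleTopology G)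
    {T : U.Etale} (a b : G.obj (op T)) :
    ∃ (E : U.Etale) (e : E ⟶ T), IsOpenImmersion e.left ∧ G.map e.op a = G.map e.op b ∧
      ∀ ⦃T' : U.Etale⦄ (f : T' ⟶ T), G.map f.op a = G.map f.op b → ∃ f' : T' ⟶ E, f' ≫ e = f := by
  -- The union of the images of all étale `T'` on which the sections agree; it is open because étale
  -- morphisms are open.
  let O : T.left.Opens := ⟨{x | ∃ (T' : U.Etale) (f : T' ⟶ T), G.map f.op a = G.map f.op b ∧
      x ∈ Set.range f.left}, by
    rw [isOpen_iff_forall_mem_open]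
    rintro x ⟨T', f, hf, hx⟩
    exact ⟨Set.range f.left, fun y hy ↦ ⟨T', f, hf, hy⟩, f.left.isOpenMap.isOpen_range, hx⟩⟩
  let e : etOver T O.ι ⟶ T := etOverπ T O.ι
  refine ⟨etOver T O.ι, e, isOpenImmersion_ι O, ?_, fun T' f hf ↦ ?_⟩
  · refine section_ext hG _ _ fun x ↦ ?_
    obtain ⟨T', f, hf, hx⟩ : e.left x ∈ O := by
      change O.ι x ∈ O
      exact x.2
    obtain ⟨W, h, w, hx, hw⟩ := exists_local_lift f e x hx
    refine ⟨W, h, hx, ?_⟩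
    rw [← map_comp_op, ← map_comp_op, hw, map_comp_op, map_comp_op, hf]
  · obtain ⟨l, hl⟩ := exists_lift_ι O f.left fun y hy ↦ ⟨T', f, hf, hy⟩
    refine ⟨homMk l ?_, ?_⟩
    · rw [etOver_hom]
      exact (Category.assoc _ _ _).symm.trans ((congrArg (· ≫ T.hom) hl).trans (left_hom f))
    · ext1
      exact hl

/-- The relation on `Y` defined by the section `y`. -/
structure EqRel (G : U.Etaleᵒᵖ ⥤ Type u) {Y : U.Etale} (y : G.obj (op Y)) where
  /-- the graph of the relation -/
  R : U.Etale
  /-- the first projection -/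
  r₁ : R ⟶ Y
  /-- the second projection -/
  r₂ : R ⟶ Y
  map_eq : G.map r₁.op y = G.map r₂.op y
  exists_lift ⦃T : U.Etale⦄ (a b : T ⟶ Y) (h : G.map a.op y = G.map b.op y) :
    ∃ w : T ⟶ R, w ≫ r₁ = a ∧ w ≫ r₂ = b

/-- The graph is the locus in `Y ×_U Y` where the two pullbacks of `y` agree. The open immersion is
recorded because the finiteness of `R` is deduced from it. -/
lemma exists_eqRel {G : U.Etaleᵒᵖ ⥤ Type u} (hG : Presieve.IsSheaf U.smallEtaleTopology G)
    {Y : U.Etale} (y : G.obj (op Y)) : ∃ E : EqRel G y,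
      ∃ i : E.R.left ⟶ pullback Y.hom Y.hom, IsOpenImmersion i := by
  let P : U.Etale := etOver Y (pullback.fst Y.hom Y.hom)
  let p₁ : P ⟶ Y := etOverπ Y _
  let p₂ : P ⟶ Y := homMk (pullback.snd Y.hom Y.hom) pullback.condition.symm
  obtain ⟨R, e, he, heq, hlift⟩ := exists_eqLocus hG (G.map p₁.op y) (G.map p₂.op y)
  refine ⟨⟨R, e ≫ p₁, e ≫ p₂, by rwa [map_comp_op, map_comp_op], fun T a b h ↦ ?_⟩, e.left, he⟩
  have hab : a.left ≫ Y.hom = b.left ≫ Y.hom := by rw [left_hom, left_hom]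
  let v : T ⟶ P := homMk (pullback.lift a.left b.left hab) (by
    rw [etOver_hom]
    exact (pullback.lift_fst_assoc _ _ _ _).trans (left_hom a))
  have hv₁ : v ≫ p₁ = a := by ext1; exact pullback.lift_fst _ _ _
  have hv₂ : v ≫ p₂ = b := by ext1; exact pullback.lift_snd _ _ _
  obtain ⟨w, hw⟩ := hlift v (by rw [← map_comp_op, ← map_comp_op, hv₁, hv₂, h])
  exact ⟨w, by rw [reassoc_of% hw, hv₁], by rw [reassoc_of% hw, hv₂]⟩

namespace EqRel

variable {G : U.Etaleᵒᵖ ⥤ Type u} {Y : U.Etale} {y : G.obj (op Y)} (E : EqRel G y)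

/-- The parallel pair underlying the relation defined by a section. -/
def parallel : ParallelOver U where
  Y := Y.left
  R := E.R.left
  π := Y.hom
  ρ := E.R.hom
  p := E.r₁.left
  q := E.r₂.left
  hp := left_hom _
  hq := left_hom _

/-- The finiteness conditions under which the affine quotient is defined. -/
class IsQCQS : Prop where
  quasiCompact_π : QuasiCompact Y.hom
  quasiSeparated_π : QuasiSeparated Y.hom
  quasiCompact_ρ : QuasiCompact E.R.hom
  quasiSeparated_ρ : QuasiSeparated E.R.hom

variable [h : E.IsQCQS]

instance : QuasiCompact E.parallel.π := h.quasiCompact_π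
instance : QuasiSeparated E.parallel.π := h.quasiSeparated_π
instance : QuasiCompact E.parallel.ρ := h.quasiCompact_ρ
instance : QuasiSeparated E.parallel.ρ := h.quasiSeparated_ρ

/-- The affine quotient by the relation defined by a section. -/
def Q : Scheme.{u} := E.parallel.quot

/-- The quotient map. -/
def t : Y.left ⟶ E.Q := E.parallel.toQuot

/-- The structure morphism of the affine quotient. -/
def f : E.Q ⟶ U := E.parallel.fromQuot

instance : IsAffineHom E.f := inferInstanceAs (IsAffineHom E.parallel.fromQuot)

@[simp] lemma t_f : E.t ≫ E.f = Y.hom := E.parallel.toQuot_fromQuot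

lemma comp_t_eq {T : U.Etale} (a b : T ⟶ Y) (h : G.map a.op y = G.map b.op y) :
    a.left ≫ E.t = b.left ≫ E.t := by
  obtain ⟨w, rfl, rfl⟩ := E.exists_lift a b h
  have := E.parallel.p_toQuot
  simp only [comp_left', Category.assoc]
  exact congrArg (w.left ≫ ·) this

/-- Over an affine étale scheme `X` over which `G` is representable, the affine quotient is
the representing scheme. -/
lemma exists_iso_pullback {X N : U.Etale} [IsAffine X.left] [IsAffine N.left] {V : U.Opens}
    (hV : IsAffineOpen V) (hX : ⊤ ≤ X.hom ⁻¹ᵁ V) {pr : N ⟶ X} {n : G.obj (op N)}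
    (hn : IsRelRep G pr n) (c : N ⟶ Y) (hc : G.map c.op y = n) :
    ∃ k : pullback E.f X.hom ⟶ N.left, IsIso k ∧ k ≫ pr.left = pullback.snd E.f X.hom ∧
      k ≫ c.left ≫ E.t = pullback.fst E.f X.hom ∧
      ∀ ⦃Z : U.Etale⦄ (a : Z ⟶ Y) (v : Z ⟶ X) (r : Z ⟶ N), r ≫ pr = v →
        G.map r.op n = G.map a.op y → ∀ w : Z.left ⟶ pullback E.f X.hom,
        w ≫ pullback.fst E.f X.hom = a.left ≫ E.t → w ≫ pullback.snd E.f X.hom = v.left →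
        w ≫ k = r.left := by
  let YX : U.Etale := etOver X (pullback.snd Y.hom X.hom)
  let iY : YX ⟶ X := etOverπ X _
  let gY : YX ⟶ Y := homMk (pullback.fst Y.hom X.hom) pullback.condition
  let RX : U.Etale := etOver X (pullback.snd E.R.hom X.hom)
  let iR : RX ⟶ X := etOverπ X _
  let gR : RX ⟶ E.R := homMk (pullback.fst E.R.hom X.hom) pullback.condition
  have HY : IsPullback gY.left iY.left Y.hom X.hom := IsPullback.of_hasPullback _ _
  have HR : IsPullback gR.left iR.left E.R.hom X.hom := IsPullback.of_hasPullback _ _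
  have HQ := IsPullback.of_hasPullback E.f X.hom
  have exists_lift {Z : U.Etale} (a : Z ⟶ Y) (v : Z ⟶ X) :
      ∃ s : Z ⟶ YX, s ≫ gY = a ∧ s ≫ iY = v := by
    let s := HY.lift a.left v.left (by rw [left_hom, left_hom])
    have h1 : s ≫ gY.left = a.left := HY.lift_fst _ _ _
    have h2 : s ≫ iY.left = v.left := HY.lift_snd _ _ _
    refine ⟨homMk s ?_, ?_, ?_⟩
    · rw [← left_hom gY, reassoc_of% h1, left_hom]
    · ext1; exact h1
    · ext1; exact h2
  obtain ⟨p, hp₁, hp₂⟩ := exists_lift (gR ≫ E.r₁) iR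
  obtain ⟨q, hq₁, hq₂⟩ := exists_lift (gR ≫ E.r₂) iR
  let tT : YX.left ⟶ pullback E.f X.hom := pullback.lift (gY.left ≫ E.t) iY.left (by
    rw [Category.assoc, t_f, HY.w])
  have ht₁ : tT ≫ pullback.fst E.f X.hom = gY.left ≫ E.t := pullback.lift_fst _ _ _
  have ht₂ : tT ≫ pullback.snd E.f X.hom = iY.left := pullback.lift_snd _ _ _
  have : IsAffine ((𝟭 Scheme).obj X.left) := ‹IsAffine X.left›
  have key {M : Scheme.{u}} [IsAffine M] (r : YX.left ⟶ M) (hr : p.left ≫ r = q.left ≫ r) :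
      ∃! k : pullback E.f X.hom ⟶ M, tT ≫ k = r :=
    E.parallel.existsUnique_comp_eq hV hX HY HR HQ congr(($hp₁).left) congr(($hp₂).left)
      congr(($hq₁).left) congr(($hq₂).left) ht₁ ht₂ r hr
  -- The classifying map of `y` restricted to `YX`. It is invariant because the pullbacks of `y`
  -- along the two projections of the relation agree, so it factors through the quotient as `k`.
  obtain ⟨r, ⟨hr₁, hr₂⟩, -⟩ := hn iY (G.map gY.op y)
  have hpq : p ≫ r = q ≫ r := by
    refine hn.hom_ext ?_ ?_
    · rw [Category.assoc, Category.assoc, hr₁, hp₂, hq₂]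
    · rw [map_comp_op, hr₂, map_comp_op, hr₂, ← map_comp_op, ← map_comp_op, hp₁, hq₁,
        map_comp_op, map_comp_op, E.map_eq]
  obtain ⟨k, hk, -⟩ := key r.left congr(($hpq).left)
  have hN : pr.left ≫ X.hom = (c.left ≫ E.t) ≫ E.f := by
    rw [left_hom, Category.assoc, t_f, left_hom]
  -- The candidate inverse of `k`, using that `N` maps to `Y` by `c`.
  let j : N.left ⟶ pullback E.f X.hom := pullback.lift (c.left ≫ E.t) pr.left hN.symm
  have hj₁ : j ≫ pullback.fst E.f X.hom = c.left ≫ E.t := pullback.lift_fst _ _ _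
  have hj₂ : j ≫ pullback.snd E.f X.hom = pr.left := pullback.lift_snd _ _ _
  have hlift {Z : U.Etale} (a : Z ⟶ Y) (v : Z ⟶ X) (r' : Z ⟶ N) (h1 : r' ≫ pr = v)
      (h2 : G.map r'.op n = G.map a.op y) (w : Z.left ⟶ pullback E.f X.hom)
      (hw₁ : w ≫ pullback.fst E.f X.hom = a.left ≫ E.t)
      (hw₂ : w ≫ pullback.snd E.f X.hom = v.left) : w ≫ k = r'.left := by
    obtain ⟨s, hs₁, hs₂⟩ := exists_lift a v
    have h3 : w = s.left ≫ tT := by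
      apply pullback.hom_ext
      · rw [hw₁, Category.assoc, ht₁, ← hs₁, comp_left', Category.assoc]
      · rw [hw₂, Category.assoc, ht₂, ← hs₂, comp_left']
    have h4 : s ≫ r = r' := by
      refine hn.hom_ext ?_ ?_
      · rw [Category.assoc, hr₁, hs₂, h1]
      · rw [map_comp_op, hr₂, ← map_comp_op, hs₁, h2]
    rw [h3, Category.assoc, hk, ← h4, comp_left']
  have hjk : j ≫ k = 𝟙 _ := hlift c pr (𝟙 N) (Category.id_comp _)
    ((map_id_op n).trans hc.symm) j hj₁ hj₂
  have hrj : r.left ≫ j = tT := by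
    apply pullback.hom_ext
    · rw [Category.assoc, hj₁, ht₁, ← Category.assoc, ← comp_left']
      exact E.comp_t_eq _ _ (by rw [map_comp_op, hc, hr₂])
    · rw [Category.assoc, hj₂, ht₂, ← comp_left', hr₁]
  have hkj : k ≫ j = 𝟙 _ := by
    have : IsAffine (pullback E.f X.hom) := .of_isPullback HQ.flip
    -- Both `k ≫ j` and the identity factor `tT` through itself, and the pulled back quotient is
    -- affine, so uniqueness applies to them.
    refine (key tT ?_).unique ?_ (Category.comp_id _)
    · apply pullback.hom_ext
      · rw [Category.assoc, Category.assoc, ht₁, ← Category.assoc, ← Category.assoc, ← comp_left',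
          ← comp_left', hp₁, hq₁]
        exact E.comp_t_eq _ _ (by rw [map_comp_op, map_comp_op, E.map_eq])
      · rw [Category.assoc, Category.assoc, ht₂, ← comp_left', ← comp_left', hp₂, hq₂]
    · rw [reassoc_of% hk, hrj]
  refine ⟨k, ⟨j, hkj, hjk⟩, ?_, ?_, fun Z a v r' h1 h2 w hw₁ hw₂ ↦ hlift a v r' h1 h2 w hw₁ hw₂⟩
  · rw [← hj₂, reassoc_of% hkj]
  · rw [← hj₁, reassoc_of% hkj]

end EqRel

end EtaleProj

/-! ### Descent of finiteness and étaleness -/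

namespace EtaleProj
open Limits Scheme

/-- A property of morphisms which is local at the target and descends along quasi-compact flat
surjections can be checked on a finite flat cover by affine schemes. -/
lemma of_pullback_snd_of_cover (P : MorphismProperty Scheme.{u}) (_ : IsZariskiLocalAtTarget P)
    (_ : P.DescendsAlong (@Surjective ⊓ @Flat ⊓ @QuasiCompact)) {U Q : Scheme.{u}} (f : Q ⟶ U)
    [IsLocallyNoetherian U] {ι : Type u} [Finite ι] (X : ι → Scheme.{u}) [∀ i, IsAffine (X i)]
    (x : ∀ i, X i ⟶ U) [∀ i, Etale (x i)] (hx : ∀ u : U, ∃ i, u ∈ Set.range (x i))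
    (h : ∀ i, P (pullback.snd f (x i))) : P f := by
  let g : (∐ X) ⟶ U := Sigma.desc x
  have hg (i : ι) : Sigma.ι X i ≫ g = x i := Sigma.ι_desc _ _
  have h1 : Etale g := IsZariskiLocalAtSource.sigmaDesc (P := @Etale) fun i ↦ inferInstance
  have h2 : Surjective g := by
    refine ⟨fun u ↦ ?_⟩
    obtain ⟨i, v, rfl⟩ := hx u
    exact ⟨Sigma.ι X i v, by rw [← Scheme.Hom.comp_apply, hg]⟩
  -- A finite disjoint union of affine schemes is compact, hence noetherian here, which makes `g`
  -- quasi-compact as descent requires.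
  have h3 : IsLocallyNoetherian (∐ X) := LocallyOfFiniteType.isLocallyNoetherian g
  have h4 : IsNoetherian (∐ X) := {}
  refine MorphismProperty.of_pullback_snd_of_descendsAlong (P := P)
    (Q := @Surjective ⊓ @Flat ⊓ @QuasiCompact) (g := g)
    ⟨⟨h2, inferInstance⟩, inferInstance⟩ ?_
  refine IsZariskiLocalAtTarget.of_openCover (sigmaOpenCover X) fun (i : ι) ↦ ?_
  change P (pullback.snd (pullback.snd f g) (Sigma.ι X i))
  have hp := (IsPullback.of_hasPullback (pullback.snd f g) (Sigma.ι X i)).paste_horiz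
    (IsPullback.of_hasPullback f g)
  rw [hg] at hp
  rw [← hp.isoPullback_hom_snd, P.cancel_left_of_respectsIso]
  exact h i

/-- Finite means affine, universally closed and locally of finite type. Affineness is given, so only
the other two properties need to descend. -/
lemma isFinite_of_pullback_snd_of_cover {U Q : Scheme.{u}} (f : Q ⟶ U) [IsAffineHom f]
    [IsLocallyNoetherian U] {ι : Type u} [Finite ι] (X : ι → Scheme.{u}) [∀ i, IsAffine (X i)]
    (x : ∀ i, X i ⟶ U) [∀ i, Etale (x i)] (hx : ∀ u : U, ∃ i, u ∈ Set.range (x i))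
    (h : ∀ i, IsFinite (pullback.snd f (x i))) : IsFinite f := by
  have h1 : UniversallyClosed f := of_pullback_snd_of_cover @UniversallyClosed
    universallyClosed_isZariskiLocalAtTarget
    descendsAlong_universallyClosed_surjective_inf_flat_inf_quasicompact
    f X x hx fun i ↦ inferInstance
  have h2 : LocallyOfFiniteType f := of_pullback_snd_of_cover @LocallyOfFiniteType
    (HasRingHomProperty.instIsZariskiLocalAtTarget _)
    instDescendsAlongSchemeLocallyOfFiniteTypeMinMorphismPropertySurjectiveFlatQuasiCompact
    f X x hx fun i ↦ inferInstance
  exact (IsFinite.iff_isIntegralHom_and_locallyOfFiniteType f).mpr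
    ⟨IsIntegralHom.iff_universallyClosed_and_isAffineHom.mpr ⟨h1, inferInstance⟩, h2⟩

lemma etale_of_pullback_snd_of_cover {U Q : Scheme.{u}} (f : Q ⟶ U)
    [IsLocallyNoetherian U] {ι : Type u} [Finite ι] (X : ι → Scheme.{u}) [∀ i, IsAffine (X i)]
    (x : ∀ i, X i ⟶ U) [∀ i, Etale (x i)] (hx : ∀ u : U, ∃ i, u ∈ Set.range (x i))
    (h : ∀ i, Etale (pullback.snd f (x i))) : Etale f :=
  of_pullback_snd_of_cover @Etale (HasRingHomProperty.instIsZariskiLocalAtTarget _)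
    instDescendsAlongSchemeEtaleMinMorphismPropertySurjectiveFlatQuasiCompact f X x hx h

variable {U : Scheme.{u}}

/-- Locally, a point of `T` whose image in `U` lifts to `A` lies on an étale `T`-scheme over `A`. -/
lemma exists_local_hom {A T : U.Etale} (x : T.left) (hx : T.hom x ∈ Set.range A.hom) :
    ∃ (W : U.Etale) (h : W ⟶ T) (_ : W ⟶ A), x ∈ Set.range h.left := by
  obtain ⟨y, hy⟩ := hx
  obtain ⟨z, hz, -⟩ := Scheme.Pullback.exists_preimage_pullback (f := T.hom) (g := A.hom) x y
    hy.symm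
  exact ⟨etOver T (pullback.fst T.hom A.hom), etOverπ _ _,
    homMk (pullback.snd T.hom A.hom) pullback.condition.symm, ⟨z, hz⟩⟩

/-- `Y` and `Y ×_U Y` are noetherian, hence so is the open subscheme `R`; morphisms out of
noetherian schemes are quasi-compact and quasi-separated. -/
lemma EqRel.isQCQS_of_isNoetherian {G : U.Etaleᵒᵖ ⥤ Type u} {Y : U.Etale} {y : G.obj (op Y)}
    (E : EqRel G y) [IsLocallyNoetherian U] [hY : CompactSpace Y.left]
    (i : E.R.left ⟶ pullback Y.hom Y.hom) [IsOpenImmersion i] : E.IsQCQS := by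
  have h0 : IsLocallyNoetherian ((Functor.fromPUnit U).obj Y.right) := ‹IsLocallyNoetherian U›
  have h1 : IsLocallyNoetherian Y.left := LocallyOfFiniteType.isLocallyNoetherian Y.hom
  have h2 : IsNoetherian Y.left := {}
  have h3 : IsNoetherian ((𝟭 Scheme).obj Y.left) := h2
  have h4 : QuasiCompact Y.hom := inferInstance
  have h5 : IsLocallyNoetherian (pullback Y.hom Y.hom) :=
    LocallyOfFiniteType.isLocallyNoetherian (pullback.fst Y.hom Y.hom)
  have h6 : CompactSpace ↥(pullback Y.hom Y.hom) :=
    QuasiCompact.compactSpace_of_compactSpace (pullback.fst Y.hom Y.hom)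
  have h7 : IsNoetherian (pullback Y.hom Y.hom) := {}
  have h8 : IsLocallyNoetherian E.R.left := isLocallyNoetherian_of_isOpenImmersion i
  have h9 : TopologicalSpace.NoetherianSpace E.R.left :=
    i.isOpenEmbedding.isInducing.noetherianSpace
  have h10 : IsLocallyNoetherian ((𝟭 Scheme).obj E.R.left) := h8
  have h11 : TopologicalSpace.NoetherianSpace ((𝟭 Scheme).obj E.R.left) := h9
  exact ⟨h4, inferInstance, inferInstance, inferInstance⟩

end EtaleProj

/-! ### Representability of locally constant sheaves of finite sets -/

namespace EtaleProj
open Limits Scheme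

variable {U : Scheme.{u}}

/-- A representation of a presheaf from a universal section. -/
def representableByOfExistsUnique {G : U.Etaleᵒᵖ ⥤ Type u} {Q : U.Etale} (z : G.obj (op Q))
    (h : ∀ ⦃T : U.Etale⦄ (a : G.obj (op T)), ∃! g : T ⟶ Q, G.map g.op z = a) :
    G.RepresentableBy Q where
  homEquiv {T} := Equiv.ofBijective (fun f : T ⟶ Q ↦ G.map f.op z)
    ⟨fun f g hfg ↦ (h (G.map g.op z)).unique hfg rfl, fun a ↦ (h a).exists⟩
  homEquiv_comp f g := map_comp_op f g z

/-- A sheaf on the small étale site that has a section through which all sections factor locally,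
and whose relation has an étale quotient, is represented by the quotient. -/
lemma nonempty_representableBy {G : U.Etaleᵒᵖ ⥤ Type u}
    (hG : Presieve.IsSheaf U.smallEtaleTopology G) {Y Q : U.Etale} (y : G.obj (op Y)) (t : Y ⟶ Q)
    (ht : ∀ q : Q.left, q ∈ Set.range t.left)
    (h : ∀ ⦃Z : U.Etale⦄ (a b : Z ⟶ Y), a ≫ t = b ≫ t ↔ G.map a.op y = G.map b.op y)
    (hy : ∀ ⦃T : U.Etale⦄ (a : G.obj (op T)) (x : T.left), ∃ (W : U.Etale) (g : W ⟶ T) (w : W ⟶ Y),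
      x ∈ Set.range g.left ∧ G.map g.op a = G.map w.op y) :
    Nonempty (G.RepresentableBy Q) := by
  -- The single morphism `t` covers `Q`, and `h` says that `y` is compatible on overlaps, so `y`
  -- descends to the section `z`, which will be universal.
  obtain ⟨z, hz⟩ := exists_section_of_compatible hG (ι := Unit) (W := fun _ ↦ Y) (fun _ ↦ t)
    (fun q ↦ ⟨(), ht q⟩) (fun _ ↦ y) fun _ _ Z a b hab ↦ (h a b).mp hab
  replace hz : G.map t.op z = y := hz ()
  have huniq {T : U.Etale} (f g : T ⟶ Q) (hfg : G.map f.op z = G.map g.op z) : f = g := by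
    refine yoneda_ext _ _ fun x ↦ ?_
    obtain ⟨W, k, w, ⟨x', rfl⟩, hw⟩ := exists_local_lift t f x (ht _)
    obtain ⟨W', k', w', ⟨x', rfl⟩, hw'⟩ := exists_local_lift t (k ≫ g) x' (ht _)
    refine ⟨W', k' ≫ k, ⟨x', rfl⟩, ?_⟩
    rw [Category.assoc, Category.assoc, hw', hw, ← Category.assoc, h, ← hz, ← map_comp_op,
      ← map_comp_op, ← hw', Category.assoc, ← hw, map_comp_op, map_comp_op _ f,
      map_comp_op _ (k ≫ g), map_comp_op _ g, hfg]
  refine ⟨representableByOfExistsUnique z fun T a ↦ ?_⟩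
  have key : ∃ f : T ⟶ Q, ∀ x : T.left, ∃ (W : U.Etale) (g : W ⟶ T), x ∈ Set.range g.left ∧
      G.map (g ≫ f).op z = G.map g.op a := by
    refine exists_section_of_unique (isSheaf_yoneda Q) (T := T)
      (fun W g (f : W ⟶ Q) ↦ G.map f.op z = G.map g.op a) (fun {W W'} f g s hs ↦ ?_)
      (fun {W} g s s' hs hs' ↦ huniq _ _ (hs.trans hs'.symm)) fun x ↦ ?_
    · change G.map (f ≫ s).op z = _
      rw [map_comp_op, hs, map_comp_op]
    · obtain ⟨W, g, w, hx, hw⟩ := hy a x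
      exact ⟨W, g, w ≫ t, hx, by rw [map_comp_op, hz, hw]⟩
  obtain ⟨f, hf⟩ := key
  refine existsUnique_of_exists_of_unique ⟨f, section_ext hG _ _ fun x ↦ ?_⟩
    fun f g hf hg ↦ huniq _ _ (hf.trans hg.symm)
  obtain ⟨W, g, hx, hg⟩ := hf x
  exact ⟨W, g, hx, by rw [← hg, map_comp_op]⟩

/-- A locally constant sheaf of finite sets on the small étale site of a locally noetherian scheme,
which is constant on finitely many affine schemes, is representable by a finite étale scheme. -/
theorem exists_isFinite_etale_representableBy [IsLocallyNoetherian U] {G : U.Etaleᵒᵖ ⥤ Type u}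
    (hG : Presieve.IsSheaf U.smallEtaleTopology G) {ι : Type u} [Finite ι] (X : ι → U.Etale)
    (hX : ∀ i, IsAffine (X i).left) (V : ι → U.Opens) (hV : ∀ i, IsAffineOpen (V i))
    (hXV : ∀ i, ⊤ ≤ (X i).hom ⁻¹ᵁ V i) (hXU : ∀ x : U, ∃ i, x ∈ Set.range (X i).hom)
    (S : ι → Type u) (hS : ∀ i, Finite (S i)) (σ : ∀ i, S i → G.obj (op (X i)))
    (hσ : ∀ i, IsConstData G (X i) (σ i)) :
    ∃ (Q : Scheme.{u}) (f : Q ⟶ U) (_ : IsFinite f) (_ : Etale f),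
      Nonempty (G.RepresentableBy (Etale.mk f)) := by
  let N (i : ι) : U.Etale := copies (X i) (S i)
  let pr (i : ι) : N i ⟶ X i := copiesπ (X i) (S i)
  have hfin (i : ι) : IsFinite (pr i).left := isFinite_copiesπ (X i) (S i)
  have hN (i : ι) : IsAffine (N i).left := isAffine_of_isAffineHom (pr i).left
  choose n hn using fun i ↦ (hσ i).exists_isRelRep hG
  let Y : U.Etale := sig N
  let c (i : ι) : N i ⟶ Y := sigι N i
  obtain ⟨y, hy⟩ : ∃ y : G.obj (op Y), ∀ i, G.map (c i).op y = n i := exists_section_sig hG N n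
  have hcompact : CompactSpace Y.left := inferInstanceAs (CompactSpace ↥(∐ fun i ↦ (N i).left))
  obtain ⟨E, e, he⟩ := exists_eqRel hG y
  have hE := E.isQCQS_of_isNoetherian e
  choose k hk hk₁ hk₂ hk₃ using fun i ↦
    E.exists_iso_pullback (hV i) (hXV i) (hn i) (c i) (hy i)
  -- The projection to `X i` is the isomorphism `k i` followed by the finite étale morphism `pr i`.
  have hfinite : IsFinite E.f := isFinite_of_pullback_snd_of_cover E.f (fun i ↦ (X i).left)
    (fun i ↦ (X i).hom) hXU fun i ↦ by rw [← hk₁]; infer_instance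
  have hetale : Etale E.f := etale_of_pullback_snd_of_cover E.f (fun i ↦ (X i).left)
    (fun i ↦ (X i).hom) hXU fun i ↦ by rw [← hk₁]; infer_instance
  refine ⟨E.Q, E.f, hfinite, hetale, nonempty_representableBy hG y
    (homMk E.t E.t_f : Y ⟶ Etale.mk E.f) (fun q ↦ ?_) (fun Z a b ↦ ⟨fun hab ↦ ?_, fun hab ↦ ?_⟩)
    fun T a x ↦ ?_⟩
  · obtain ⟨i, x, hx⟩ := hXU (E.f q)
    obtain ⟨z, hz, -⟩ := Scheme.Pullback.exists_preimage_pullback (f := E.f) (g := (X i).hom) q x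
      hx.symm
    refine ⟨(c i).left (k i z), ?_⟩
    rw [← hz, ← hk₂ i]
    rfl
  · refine section_ext hG _ _ fun x ↦ ?_
    obtain ⟨i, hi⟩ := hXU (Z.hom x)
    obtain ⟨W, g, v, hx⟩ := exists_local_hom x hi
    refine ⟨W, g, hx, ?_⟩
    rw [← map_comp_op, ← map_comp_op]
    -- Over `X i`, the classifying maps of the two pulled back sections both equal `w ≫ k i`, and
    -- `w` depends only on the common composite with `t`.
    obtain ⟨r, ⟨hr₁, hr₂⟩, -⟩ := hn i v (G.map (g ≫ a).op y)
    obtain ⟨r', ⟨hr'₁, hr'₂⟩, -⟩ := hn i v (G.map (g ≫ b).op y)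
    have h0 : (g ≫ a).left ≫ E.t = (g ≫ b).left ≫ E.t := by
      rw [comp_left', comp_left', Category.assoc, Category.assoc]
      exact congrArg (g.left ≫ ·) congr(($hab).left)
    let w : W.left ⟶ pullback E.f (X i).hom := pullback.lift ((g ≫ a).left ≫ E.t) v.left (by
      rw [Category.assoc, E.t_f, left_hom, left_hom])
    have hw₁ : w ≫ pullback.fst E.f (X i).hom = (g ≫ a).left ≫ E.t := pullback.lift_fst _ _ _
    have hw₂ : w ≫ pullback.snd E.f (X i).hom = v.left := pullback.lift_snd _ _ _
    have h1 : r = r' := by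
      ext1
      rw [← hk₃ i (g ≫ a) v r hr₁ hr₂ w hw₁ hw₂,
        ← hk₃ i (g ≫ b) v r' hr'₁ hr'₂ w (hw₁.trans h0) hw₂]
    rw [← hr₂, ← hr'₂, h1]
  · ext1
    exact E.comp_t_eq a b hab
  · obtain ⟨i, hi⟩ := hXU (T.hom x)
    obtain ⟨W, g, v, hx⟩ := exists_local_hom x hi
    obtain ⟨r, ⟨hr₁, hr₂⟩, -⟩ := hn i v (G.map g.op a)
    exact ⟨W, g, r ≫ c i, hx, by rw [map_comp_op, hy, hr₂]⟩

end EtaleProj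

/-! ### Constant sheaves of modules -/

namespace EtaleProj
open Limits Scheme

variable {U : Scheme.{u}}

lemma exists_mem_range_of_mem {T : U.Etale} {S : Sieve T} (hS : S ∈ U.smallEtaleTopology T)
    (x : T.left) : ∃ (W : U.Etale) (g : W ⟶ T), S.arrows g ∧ x ∈ Set.range g.left := by
  have h : S = Sieve.ofArrows (I := Σ W : U.Etale, {g : W ⟶ T // S.arrows g}) (fun i ↦ i.1)
      fun i ↦ i.2.1 := by
    ext W g
    refine ⟨fun hg ↦ ⟨W, 𝟙 W, g, .mk (ι := Σ W : U.Etale, {g : W ⟶ T // S.arrows g})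
      (Y := fun i ↦ i.1) (f := fun i ↦ i.2.1) ⟨W, g, hg⟩, Category.id_comp g⟩, ?_⟩
    rintro ⟨_, a, _, ⟨⟨W', g', hg'⟩⟩, rfl⟩
    exact S.downward_closed hg' a
  rw [h, ofArrows_mem_smallEtaleTopology_iff] at hS
  have hx : x ∈ ⋃ i : Σ W : U.Etale, {g : W ⟶ T // S.arrows g}, Set.range i.2.1.left :=
    hS.symm ▸ Set.mem_univ x
  obtain ⟨⟨W, g, hg⟩, hx⟩ := Set.mem_iUnion.mp hx
  exact ⟨W, g, hg, hx⟩

/-- Applied to a constant presheaf, this turns an isomorphism with the constant sheaf into local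
statements about elements of the value. -/
lemma exists_locally_bijective_of_iso_sheafify {C : Type*} [Category* C]
    (J : GrothendieckTopology C) {R : Type} [Ring R] [HasWeakSheafify J (ModuleCat.{u} R)]
    [J.WEqualsLocallyBijective (ModuleCat.{u} R)] (P Q : Cᵒᵖ ⥤ ModuleCat.{u} R)
    (e : Q ≅ sheafify J P) :
    ∃ α : P ⟶ Q, Presheaf.IsLocallyInjective J α ∧ Presheaf.IsLocallySurjective J α :=
  ⟨toSheafify J P ≫ e.inv, inferInstance, inferInstance⟩

/-- The sections of a sheaf of modules which is constant on `X` defined by the elements of its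
value. -/
lemma IsConstantOn.exists_isConstData {R : Type} [Ring R] {V : ModSheaf U R} {X : U.Etale}
    {M : ModuleCat.{u} R} (h : IsConstantOn V X M) :
    ∃ m : M →ₗ[R] V.obj.obj (op X),
      IsConstData (V.obj ⋙ forget (ModuleCat.{u} R)) X fun v : M ↦ m v := by
  obtain ⟨e⟩ := h
  let J := X.left.smallEtaleTopology
  obtain ⟨α, hinj, hsurj⟩ := exists_locally_bijective_of_iso_sheafify J
    ((Functor.const X.left.Etaleᵒᵖ).obj M) ((postcomp X).op ⋙ V.obj) e
  -- `X₁` is final in the étale site of `X`, so `α` is determined by its value there (`hα`). The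
  -- maps `j` and `i g` are identities on underlying schemes and translate between the sites of `X`
  -- and `U`.
  let X₁ : X.left.Etale := Etale.mk (𝟙 X.left)
  let j : X ⟶ (postcomp X).obj X₁ := homMk (𝟙 X.left) (by
    change 𝟙 _ ≫ 𝟙 _ ≫ X.hom = X.hom
    rw [Category.id_comp, Category.id_comp])
  let i {T : U.Etale} (g : T ⟶ X) : (postcomp X).obj (Etale.mk g.left) ⟶ T := homMk (𝟙 T.left) (by
    exact (Category.id_comp _).trans (left_hom g).symm)
  let t (W : X.left.Etale) : W ⟶ X₁ := homMk W.hom (Category.comp_id _)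
  have hα (W : X.left.Etale) (v : M) : α.app (op W) v =
      V.obj.map ((postcomp X).map (t W)).op (α.app (op X₁) v) :=
    congr($(α.naturality (t W).op) v)
  have hj {W : X.left.Etale} {T : U.Etale} (g : T ⟶ X) (h : W ⟶ Etale.mk g.left) :
      ((postcomp X).map h ≫ i g) ≫ g ≫ j = (postcomp X).map (t W) := by
    ext1
    change (h.left ≫ 𝟙 _) ≫ g.left ≫ 𝟙 _ = W.hom
    exact (congr($(Category.comp_id h.left) ≫ $(Category.comp_id g.left))).trans (left_hom h)
  have hmap {A B C : U.Etale} (f : A ⟶ B) (g : B ⟶ C) (c : V.obj.obj (op C)) :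
      V.obj.map (f ≫ g).op c = V.obj.map f.op (V.obj.map g.op c) := by
    rw [op_comp, Functor.map_comp, ConcreteCategory.comp_apply]
  refine ⟨(α.app (op X₁) ≫ V.obj.map j.op).hom, fun {T} g a x ↦ ?_, fun {T} g v v' ⟨x⟩ hv ↦ ?_⟩
  · obtain ⟨W, h, ⟨v, hv⟩, hx⟩ := exists_mem_range_of_mem
      (Presheaf.imageSieve_mem J α (U := op (Scheme.Etale.mk g.left)) (V.obj.map (i g).op a)) x
    refine ⟨(postcomp X).obj W, (postcomp X).map h ≫ i g, v, ?_, ?_⟩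
    · obtain ⟨w, hw⟩ := hx
      exact ⟨w, hw⟩
    · change V.obj.map ((postcomp X).map h ≫ i g).op a =
        V.obj.map (((postcomp X).map h ≫ i g) ≫ g).op
        (V.obj.map j.op (α.app (op X₁) v))
      rw [← hmap, Category.assoc _ g j, hj, ← hα, hv, hmap]
      rfl
  · change V.obj.map g.op (V.obj.map j.op (α.app (op X₁) v)) =
      V.obj.map g.op (V.obj.map j.op (α.app (op X₁) v')) at hv
    have h1 : α.app (op (Scheme.Etale.mk g.left)) v = α.app (op (Scheme.Etale.mk g.left)) v' := by
      rw [hα _ v, hα _ v', ← hj g (𝟙 _)]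
      simp only [hmap]
      rw [hv]
    -- Restriction maps of the constant presheaf are identities, so agreement on one member of the
    -- cover is already `v = v'`; the point `x` provides a member.
    obtain ⟨W, f, hf, -⟩ := exists_mem_range_of_mem (Presheaf.equalizerSieve_mem J α v v' h1) x
    exact hf

end EtaleProj

/-! ### The projectivisation of a constant sheaf -/

namespace EtaleProj
open Limits Scheme

variable {U : Scheme.{u}} {ℓ n : ℕ}

/-- Two elements of `M^*` are equivalent if they differ by a unit. -/
def starOrbitSetoid (ℓ n : ℕ) (M : Type u) [AddCommGroup M] [Module (Lam ℓ n) M] :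
    Setoid (starSet ℓ n M) where
  r v w := ∃ c : (Lam ℓ n)ˣ, (c : Lam ℓ n) • (v : M) = w
  iseqv :=
    { refl := fun v ↦ ⟨1, by simp⟩
      symm := fun {v w} ⟨c, hc⟩ ↦ ⟨c⁻¹, by rw [← hc, smul_smul]; simp⟩
      trans := fun {v w x} ⟨c, hc⟩ ⟨d, hd⟩ ↦
        ⟨d * c, by rw [← hd, ← hc, smul_smul, Units.val_mul]⟩ }

lemma module_map_comp_op {V : ModSheaf U (Lam ℓ n)} {A B C : U.Etale} (f : A ⟶ B) (g : B ⟶ C)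
    (c : V.obj.obj (op C)) :
    V.obj.map (f ≫ g).op c = V.obj.map f.op (V.obj.map g.op c) := by
  rw [op_comp, Functor.map_comp, ConcreteCategory.comp_apply]

/-- Restriction is linear and injective on constant sections over a nonempty `T`, so the
nonvanishing of `ℓ ^ (n - 1) • v` can be tested in `M`. -/
lemma map_mem_starSet_iff {V : ModSheaf U (Lam ℓ n)} {X : U.Etale} {M : ModuleCat.{u} (Lam ℓ n)}
    {m : M →ₗ[Lam ℓ n] V.obj.obj (op X)}
    (hm : IsConstData (V.obj ⋙ forget (ModuleCat.{u} (Lam ℓ n))) X fun v : M ↦ m v)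
    {T : U.Etale} (g : T ⟶ X) (hT : Nonempty T.left) (v : M) :
    (V.obj.map g.op).hom (m v) ∈ starSet ℓ n (V.obj.obj (op T)) ↔ v ∈ starSet ℓ n M := by
  have h : ℓ ^ (n - 1) • (V.obj.map g.op).hom (m v) =
      (V.obj.map g.op).hom (m (ℓ ^ (n - 1) • v)) := by
    rw [map_nsmul, map_nsmul]
  have h0 : (V.obj.map g.op).hom (m 0) = 0 := by rw [map_zero, map_zero]
  refine not_congr ⟨fun hv ↦ ?_, fun hv ↦ ?_⟩
  · exact hm.eq_of_map_eq g (ℓ ^ (n - 1) • v) 0 hT (h.symm.trans (hv.trans h0.symm))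
  · rw [h, hv, h0]

/-- If `V` is constant on `X` with value `M`, then `Pₙ(V)` is constant on `X` with value the set of
orbits of units on `M^*`. -/
lemma exists_isConstData_proj {V : ModSheaf U (Lam ℓ n)} {X : U.Etale}
    {M : ModuleCat.{u} (Lam ℓ n)} {m : M →ₗ[Lam ℓ n] V.obj.obj (op X)}
    (hm : IsConstData (V.obj ⋙ forget (ModuleCat.{u} (Lam ℓ n))) X fun v : M ↦ m v) :
    ∃ σ : Quotient (starOrbitSetoid ℓ n M) → (proj V).obj.obj (op X),
      IsConstData (proj V).obj X σ := by
  let J := U.smallEtaleTopology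
  let P := projPresheaf V
  let η : P ⟶ (proj V).obj := toSheafify J P
  have hinj : Presheaf.IsLocallyInjective J η :=
    inferInstanceAs (Presheaf.IsLocallyInjective J (toSheafify J P))
  have hsurj : Presheaf.IsLocallySurjective J η :=
    inferInstanceAs (Presheaf.IsLocallySurjective J (toSheafify J P))
  have hη {A B : U.Etale} (f : A ⟶ B) (b : P.obj (op B)) :
      η.app (op A) (P.map f.op b) = (proj V).obj.map f.op (η.app (op B) b) :=
    congr($(η.naturality f.op) b)
  let s (v : starSet ℓ n M) : (starSubfunctor V).obj (op X) :=
    ⟨m v.1, fun T' f hT' ↦ (map_mem_starSet_iff hm f hT' v.1).mpr v.2⟩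
  let τ : Quotient (starOrbitSetoid ℓ n M) → P.obj (op X) :=
    Quotient.map' s (by
      rintro v w ⟨c, hc⟩
      exact ⟨c, (map_smul m _ _).symm.trans (congrArg m hc)⟩)
  have hτ (v : starSet ℓ n M) : τ (Quotient.mk _ v) =
      Quotient.mk (orbitSetoid V (op X)) (s v) := rfl
  refine ⟨fun v ↦ η.app (op X) (τ v), fun {T} g a x ↦ ?_, fun {T} g v w hT h ↦ ?_⟩
  -- Locally `a` is the class of a section `b` of `V^*`, and after a further refinement `b` is a
  -- constant section `v`.
  · obtain ⟨W, h, ⟨b, hb⟩, ⟨x, rfl⟩⟩ := exists_mem_range_of_mem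
      (Presheaf.imageSieve_mem J η (U := op T) a) x
    induction b using Quotient.inductionOn with | _ b
    obtain ⟨W', h', v, ⟨x, rfl⟩, hv⟩ := hm.exists_eq (h ≫ g) b.1 x
    change (V.obj.map h'.op).hom b.1 = (V.obj.map (h' ≫ h ≫ g).op).hom (m v) at hv
    have hvs : v ∈ starSet ℓ n M := by
      rw [← map_mem_starSet_iff hm (h' ≫ h ≫ g) ⟨x⟩, ← hv]
      exact b.2 W' h' ⟨x⟩
    refine ⟨W', h' ≫ h, Quotient.mk _ ⟨v, hvs⟩, ⟨x, rfl⟩, ?_⟩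
    rw [map_comp_op, ← hb]
    refine (hη h' _).symm.trans (Eq.trans ?_ (hη ((h' ≫ h) ≫ g) _))
    refine congrArg (η.app (op W')) (congrArg (Quotient.mk (orbitSetoid V (op W')))
      (Subtype.ext ?_))
    rw [Category.assoc]
    exact hv
  · induction v using Quotient.inductionOn with | _ v
    induction w using Quotient.inductionOn with | _ w
    rw [← hη, ← hη, hτ, hτ] at h
    obtain ⟨x⟩ := hT
    -- Equality after sheafification gives, on a nonempty `W`, a single unit relating the two
    -- sections; the relation then already holds in `M`.
    obtain ⟨W, f, hf, ⟨x, rfl⟩⟩ := exists_mem_range_of_mem (Presheaf.equalizerSieve_mem J η _ _ h) x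
    obtain ⟨c, hc⟩ := Quotient.exact hf
    refine Quotient.sound ⟨c, ?_⟩
    refine hm.eq_of_map_eq (f ≫ g) _ _ ⟨x⟩ ?_
    change (V.obj.map (f ≫ g).op).hom (m ((c : Lam ℓ n) • v.1)) = (V.obj.map (f ≫ g).op).hom (m w.1)
    rw [map_smul, map_smul]
    refine (congrArg ((c : Lam ℓ n) • ·) (module_map_comp_op f g (m v.1))).trans
      (Eq.trans ?_ (module_map_comp_op f g (m w.1)).symm)
    exact hc

end EtaleProj

/-! ### Finite trivializing covers and the theorem -/

namespace EtaleProj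
open Limits Scheme

variable {U : Scheme.{u}}

/-- A point of an étale `U`-scheme has an affine open neighbourhood whose image in `U` is contained
in an affine open subset. -/
lemma exists_isAffine_hom (X : U.Etale) (x : X.left) :
    ∃ (X' : U.Etale) (g : X' ⟶ X) (V : U.Opens), IsAffine X'.left ∧ IsAffineOpen V ∧
      ⊤ ≤ X'.hom ⁻¹ᵁ V ∧ x ∈ Set.range g.left := by
  obtain ⟨V, hV, hxV, -⟩ := exists_isAffineOpen_mem_and_subset (U := (⊤ : U.Opens))
    (x := X.hom x) trivial
  obtain ⟨W, hW, hxW, hWV⟩ := exists_isAffineOpen_mem_and_subset (X := X.left)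
    (U := X.hom ⁻¹ᵁ V) (x := x) hxV
  refine ⟨etOver X (Scheme.Opens.ι (X := X.left) W), etOverπ X _, V, hW, hV, ?_, ⟨⟨x, hxW⟩, rfl⟩⟩
  rintro ⟨z, hz⟩ -
  exact hWV hz

/-- On a quasi-compact scheme, the projectivisation of a locally constant sheaf of free modules of
finite rank becomes constant on finitely many affine étale schemes. -/
lemma exists_finite_isConstData_proj [CompactSpace U] {ℓ n : ℕ} (hℓ : ℓ ≠ 0)
    (V : ModSheaf U (Lam ℓ n)) (hV : IsLocallyConstantFree V) :
    ∃ (ι : Type u) (_ : Finite ι) (X : ι → U.Etale) (W : ι → U.Opens) (S : ι → Type u)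
      (σ : ∀ i, S i → (proj V).obj.obj (op (X i))),
      (∀ i, IsAffine (X i).left ∧ IsAffineOpen (W i) ∧ ⊤ ≤ (X i).hom ⁻¹ᵁ W i ∧ Finite (S i) ∧
        IsConstData (proj V).obj (X i) (σ i)) ∧ ∀ x : U, ∃ i, x ∈ Set.range (X i).hom := by
  obtain ⟨I, X, hX, hM⟩ := hV
  have hpt (x : U) : ∃ (X' : U.Etale) (W : U.Opens) (S : Type u)
      (σ : S → (proj V).obj.obj (op X')), (IsAffine X'.left ∧ IsAffineOpen W ∧ ⊤ ≤ X'.hom ⁻¹ᵁ W ∧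
        Finite S ∧ IsConstData (proj V).obj X' σ) ∧ x ∈ Set.range X'.hom := by
    -- The covering condition is applied to the final object `U`.
    obtain ⟨T, g, ⟨i, ⟨a⟩⟩, ⟨y, hy⟩⟩ := exists_mem_range_of_mem (hX (Etale.mk (𝟙 U))) x
    obtain ⟨M, hfree, hfin, hconst⟩ := hM i
    obtain ⟨m, hm⟩ := hconst.exists_isConstData
    obtain ⟨σ, hσ⟩ := exists_isConstData_proj hm
    obtain ⟨X', g', W, h1, h2, h3, ⟨z, hz⟩⟩ := exists_isAffine_hom T y
    have : NeZero (ℓ ^ n) := ⟨pow_ne_zero _ hℓ⟩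
    have : Finite M := Module.finite_of_finite (Lam ℓ n)
    refine ⟨X', W, _, _, ⟨h1, h2, h3, inferInstance, hσ.restrict (g' ≫ a)⟩, z, ?_⟩
    rw [← left_hom (g' ≫ g), comp_left', ← hy, ← hz]
    rfl
  choose X' W S σ h1 h2 using hpt
  -- Étale morphisms are open, so compactness of `U` leaves finitely many.
  obtain ⟨t, ht⟩ := isCompact_univ.elim_finite_subcover (fun x : U ↦ Set.range (X' x).hom)
    (fun x ↦ (X' x).hom.isOpenMap.isOpen_range) fun x _ ↦ Set.mem_iUnion.mpr ⟨x, h2 x⟩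
  refine ⟨t, inferInstance, fun x ↦ X' x, fun x ↦ W x, fun x ↦ S x, fun x ↦ σ x, fun x ↦ h1 x,
    fun x ↦ ?_⟩
  obtain ⟨y, hy, hxy⟩ := Set.mem_iUnion₂.mp (ht (Set.mem_univ x))
  exact ⟨⟨y, hy⟩, hxy⟩

end EtaleProj

theorem mainTheorem6 {k : Type u} [Field k] (p ℓ : ℕ) [Fact p.Prime] [CharP k p]
    (hℓ : ℓ.Prime) (hℓp : ℓ ≠ p)
    {U : Scheme.{u}} (f : U ⟶ Spec (.of k))
    [SmoothOfRelativeDimension 1 f] [IsSeparated f] [QuasiCompact f]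
    (n : ℕ) (hn : 1 ≤ n)
    (V : EtaleProj.ModSheaf U (EtaleProj.Lam ℓ n)) (hV : EtaleProj.IsLocallyConstantFree V) :
    ∃ (Un : Scheme.{u}) (π : Un ⟶ U) (_ : IsFinite π) (_ : Etale π),
      Nonempty ((EtaleProj.proj V).obj.RepresentableBy (Scheme.Etale.mk π)) := by
  have : Smooth f := SmoothOfRelativeDimension.smooth 1 f
  have : IsLocallyNoetherian U := LocallyOfFiniteType.isLocallyNoetherian f
  have : CompactSpace U := QuasiCompact.compactSpace_of_compactSpace f
  obtain ⟨ι, _, X, W, S, σ, h, hU⟩ := EtaleProj.exists_finite_isConstData_proj hℓ.ne_zero V hV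
  exact EtaleProj.exists_isFinite_etale_representableBy
    ((isSheaf_iff_isSheaf_of_type _ _).mp (EtaleProj.proj V).property) X (fun i ↦ (h i).1) W
    (fun i ↦ (h i).2.1) (fun i ↦ (h i).2.2.1) hU S (fun i ↦ (h i).2.2.2.1) σ
    fun i ↦ (h i).2.2.2.2

end
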